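/- **Lemma 3.** Let $\Theta\subseteq\mathbb R^k$ be open and let $S(\omega|\theta)$, $\theta\in\Theta$, be a parametric family of ARMA spectral densities: for each $\theta\in\Theta$ there are orders $p,q$, real coefficients and a variance $\sigma^2>0$ with $$S(\omega|\theta)=\frac{\sigma^2}{2\pi}\,\frac{|b(e^{-i\omega})|^2}{|a(e^{-i\omega})|^2},\qquad a(z)=1-\sum_{r=1}^p\phi_rz^r,\quad b(z)=1+\sum_{r=1}^q\psi_rz^r,$$ where $a$ and $b$ have no zeros on $|z|=1$. Assume that $S$ is three times continuously differentiable in $(\theta,\omega)$. Let $\Sigma_n(\theta)=\big(\int_{-\pi}^{\pi}e^{i(s-t)\omega}S(\omega|\theta)\,d\omega\big)_{s,t=1}^n$ be the covariance matrix of a sample $X_n=(x_1,\dots,x_n)'$ of the mean-zero stationary Gaussian process with spectral density $S(\cdot|\theta)$, and $$l_n(\theta)=-\tfrac12X_n'\Sigma_n(\theta)^{-1}X_n-\tfrac12\log\det\Sigma_n(\theta).$$ Fix $\theta_0\in\Theta$. With $\partial_i=\partial/\partial\theta^i$, all derivatives taken at $\theta_0$, and $E$ the expectation under $X_n\sim N(0,\Sigma_n(\theta_0))$,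 put $L_i=\frac1n\partial_il_n$, $L_{ij}=\frac1n\partial_i\partial_jl_n$, $L_{ijk}=\frac1n\partial_i\partial_j\partial_kl_n$, and $$m_{ij}=E[L_{ij}],\qquad m_{ijk}=E[L_{ijk}],\qquad m_{ij,k}=E[L_{ij}L_k],$$ and let $(m^{ij})$ be the inverse matrix of $(m_{ij})$. Put, at $\theta=\theta_0$, $$g_{ij}=\int_{-\pi}^{\pi}\frac{d\omega}{4\pi}\,\partial_i\log S\,\partial_j\log S,\qquad \Gamma^{(m)}_{i,jk}=\int_{-\pi}^{\pi}\frac{d\omega}{4\pi}\,\partial_i\log S\,\frac{\partial_j\partial_kS}{S},$$ $$T_{ijk}=\int_{-\pi}^{\pi}\frac{d\omega}{2\pi}\,\partial_i\log S\,\partial_j\log S\,\partial_k\log S,\qquad \Gamma^{(e)}_{i,jk}=\Gamma^{(m)}_{i,jk}-T_{ijk},$$ and, if $(g_{ij})$ is invertible, let $(g^{ij})$ be its inverse matrix. Then $\Sigma_n(\theta_0)$ is positive definite for every $n$, $l_n$ is $C^3$ near $\theta_0$, the expectations above exist, and for all indices $i,j,k$, as $n\to\infty$, $$m_{ij}=-g_{ij}+O(n^{-1})=O(1),$$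 $$m_{ijk}=2T_{ijk}-\big(\Gamma^{(m)}_{i,jk}+\Gamma^{(m)}_{j,ik}+\Gamma^{(m)}_{k,ij}\big)+O(n^{-1})=-\big(\Gamma^{(e)}_{i,jk}+\Gamma^{(e)}_{j,ik}+\Gamma^{(e)}_{k,ij}+T_{ijk}\big)+O(n^{-1})=O(1),$$ $$n\,m_{ij,k}=\Gamma^{(m)}_{k,ij}-T_{ijk}+O(n^{-1})=\Gamma^{(e)}_{k,ij}+O(n^{-1})=O(1).$$ If the matrix $(g_{ij})$ is invertible, then $(m_{ij})$ is invertible for all large $n$ and $$m^{ij}=-g^{ij}+O(n^{-1})=O(1).$$ -/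

import Mathlib

open MeasureTheory ProbabilityTheory Filter Matrix
open scoped Topology Asymptotics Real

noncomputable section

namespace ARMA

/-- The autoregressive polynomial `1 - φ₁ z - ⋯ - φ_p z ^ p`. -/
def arPoly {p : ℕ} (φ : Fin p → ℝ) (z : ℂ) : ℂ := 1 - ∑ j : Fin p, (φ j : ℂ) * z ^ (j.val + 1)

/-- The moving average polynomial `1 + ψ₁ z + ⋯ + ψ_q z ^ q`. -/
def maPoly {q : ℕ} (ψ : Fin q → ℝ) (z : ℂ) : ℂ := 1 + ∑ j : Fin q, (ψ j : ℂ) * z ^ (j.val + 1)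

/-- `f` is the spectral density of a stationary ARMA process
`x_t - φ₁ x_{t-1} - ⋯ - φ_p x_{t-p} = e_t + ψ₁ e_{t-1} + ⋯ + ψ_q e_{t-q}` with white noise `e_t` of
variance `v > 0`, where neither polynomial vanishes on the unit circle (in particular, this covers
all causal and invertible ARMA processes). -/
def IsSpectralDensity (f : ℝ → ℝ) : Prop :=
  ∃ (p q : ℕ) (φ : Fin p → ℝ) (ψ : Fin q → ℝ) (v : ℝ), 0 < v ∧
    (∀ z : ℂ, ‖z‖ = 1 → arPoly φ z ≠ 0) ∧ (∀ z : ℂ, ‖z‖ = 1 → maPoly ψ z ≠ 0) ∧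
    ∀ ω : ℝ, f ω = v / (2 * π) * (‖maPoly ψ (Complex.exp (-(ω * Complex.I)))‖ ^ 2 /
      ‖arPoly φ (Complex.exp (-(ω * Complex.I)))‖ ^ 2)

variable {k : ℕ}

/-- A regular parametric ARMA model: a family `S(ω | θ)`, written `S θ ω`, of ARMA spectral
densities indexed by an open set `Θ ⊆ ℝ ^ k`, three times continuously differentiable in
`(θ, ω)`. -/
structure IsModel (Θ : Set (Fin k → ℝ)) (S : (Fin k → ℝ) → ℝ → ℝ) : Prop where
  isOpen : IsOpen Θ
  spectral : ∀ θ ∈ Θ, IsSpectralDensity (S θ)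
  smooth : ContDiffOn ℝ 3 (fun y : (Fin k → ℝ) × ℝ => S y.1 y.2) (Θ ×ˢ Set.univ)

/-- The partial derivative `∂_i f (θ)`. -/
def pd (i : Fin k) (f : (Fin k → ℝ) → ℝ) (θ : Fin k → ℝ) : ℝ := lineDeriv ℝ f θ (Pi.single i 1)

/-- `∂_i ∂_j f (θ)`. -/
def pd2 (i j : Fin k) (f : (Fin k → ℝ) → ℝ) (θ : Fin k → ℝ) : ℝ := pd i (pd j f) θ

/-- `∂_i ∂_j ∂_l f (θ)`. -/
def pd3 (i j l : Fin k) (f : (Fin k → ℝ) → ℝ) (θ : Fin k → ℝ) : ℝ := pd i (pd j (pd l f)) θ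

variable (S : (Fin k → ℝ) → ℝ → ℝ)

/-! ### Spectral geometric quantities -/

/-- `∂_i log S(ω | θ)`. -/
def dlog (θ : Fin k → ℝ) (i : Fin k) (ω : ℝ) : ℝ := pd i (fun t => Real.log (S t ω)) θ

/-- The metric `g_{ij}`. -/
def metric (θ : Fin k → ℝ) : Matrix (Fin k) (Fin k) ℝ :=
  Matrix.of fun i j => ∫ ω in (-π)..π, dlog S θ i ω * dlog S θ j ω / (4 * π)

/-- The coefficients `Γ^{(m)}_{i,jl}`. -/
def gammaM (θ : Fin k → ℝ) (i j l : Fin k) : ℝ :=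
  ∫ ω in (-π)..π, dlog S θ i ω * (pd2 j l (fun t => S t ω) θ / S θ ω) / (4 * π)

/-- The tensor `T_{ijl}`. -/
def tensorT (θ : Fin k → ℝ) (i j l : Fin k) : ℝ :=
  ∫ ω in (-π)..π, dlog S θ i ω * dlog S θ j ω * dlog S θ l ω / (2 * π)

/-- The coefficients `Γ^{(e)}_{i,jl} = Γ^{(m)}_{i,jl} - T_{ijl}`. -/
def gammaE (θ : Fin k → ℝ) (i j l : Fin k) : ℝ := gammaM S θ i j l - tensorT S θ i j l

/-! ### Log likelihood of the Gaussian process with spectral density `S(ω | θ)` -/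

/-- The covariance matrix `Σ_n(θ)` of `(x_1, …, x_n)`. As `S(· | θ)` is even, the autocovariance
at lag `h` is `∫ exp (i h ω) S(ω | θ) dω = ∫ cos (h ω) S(ω | θ) dω`. -/
def cov (n : ℕ) (θ : Fin k → ℝ) : Matrix (Fin n) (Fin n) ℝ :=
  Matrix.of fun s t => ∫ ω in (-π)..π, Real.cos (((s.val : ℝ) - (t.val : ℝ)) * ω) * S θ ω

/-- The law of `X_n = (x_1, …, x_n)` under the parameter `θ`. -/
def law (n : ℕ) (θ : Fin k → ℝ) : Measure (EuclideanSpace ℝ (Fin n)) :=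
  multivariateGaussian 0 (cov S n θ)

/-- The log likelihood `l_n(θ)` at the sample `x`, without its constant term. -/
def logLik (n : ℕ) (x : EuclideanSpace ℝ (Fin n)) (θ : Fin k → ℝ) : ℝ :=
  -(1 / 2) * (x.ofLp ⬝ᵥ ((cov S n θ)⁻¹ *ᵥ x.ofLp)) - 1 / 2 * Real.log (cov S n θ).det

/-- `L_i(θ) = n⁻¹ ∂_i l_n(θ)`. -/
def L1 (n : ℕ) (θ : Fin k → ℝ) (i : Fin k) (x : EuclideanSpace ℝ (Fin n)) : ℝ :=
  (n : ℝ)⁻¹ * pd i (logLik S n x) θ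

/-- `L_{ij}(θ) = n⁻¹ ∂_i ∂_j l_n(θ)`. -/
def L2 (n : ℕ) (θ : Fin k → ℝ) (i j : Fin k) (x : EuclideanSpace ℝ (Fin n)) : ℝ :=
  (n : ℝ)⁻¹ * pd2 i j (logLik S n x) θ

/-- `L_{ijl}(θ) = n⁻¹ ∂_i ∂_j ∂_l l_n(θ)`. -/
def L3 (n : ℕ) (θ : Fin k → ℝ) (i j l : Fin k) (x : EuclideanSpace ℝ (Fin n)) : ℝ :=
  (n : ℝ)⁻¹ * pd3 i j l (logLik S n x) θ

/-- The matrix `m_{ij}(θ) = E_{θ₀}[L_{ij}(θ)]`. -/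
def m2 (n : ℕ) (θ₀ θ : Fin k → ℝ) : Matrix (Fin k) (Fin k) ℝ :=
  Matrix.of fun i j => ∫ x, L2 S n θ i j x ∂(law S n θ₀)

/-- `m_{ijl}(θ) = E_{θ₀}[L_{ijl}(θ)]`. -/
def m3 (n : ℕ) (θ₀ θ : Fin k → ℝ) (i j l : Fin k) : ℝ := ∫ x, L3 S n θ i j l x ∂(law S n θ₀)

/-- `m_{ij,l}(θ) = E_{θ₀}[L_{ij}(θ) L_l(θ)]`. -/
def m21 (n : ℕ) (θ₀ θ : Fin k → ℝ) (i j l : Fin k) : ℝ :=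
  ∫ x, L2 S n θ i j x * L1 S n θ l x ∂(law S n θ₀)

end ARMA

end

/-!
Write `W = Σ_n⁻¹` and `Σ_i`, `Σ_{ij}`, … for the derivatives of the covariance matrix, and
`τ(X, Y, …) = tr (W X W Y ⋯)`. The derivatives of the log likelihood are quadratic forms in the
sample plus constants, so that the moments of order two and four of a Gaussian vector (Isserlis'
theorem, `integral_quadraticForm_mul`) give exact formulas: `n m_{ij}` is `-τ(Σ_i, Σ_j) / 2`,
`n m_{ijl}` is `2 τ(Σ_i, Σ_j, Σ_l)` minus half of the sum of the three `τ(Σ_{ij}, Σ_l)`, and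
`n² m_{ij,l}` is `τ(Σ_{ij}, Σ_l) / 2 - τ(Σ_i, Σ_j, Σ_l)` (`IsCovFamily.integral_pd2`,
`IsCovFamily.integral_pd3`, `IsCovFamily.integral_pd2_mul_pd`). The traces of `W Σ_{ijl}` cancel;
this matters, because the third derivatives of `S` in `θ` are only continuous in `ω`.

The matrices `Σ_n`, `Σ_i`, `Σ_{ij}` are the Toeplitz matrices of `2π S`, `2π ∂_i S`, `2π ∂_i ∂_j S`,
which are even and `C¹` in `ω`. For such symbols `T_n(f) T_n(g)` and `T_n(f g)` differ by a matrix
whose trace norm is bounded in `n` (`traceNormBounded_toeplitz_mul`): the difference is a sum of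
products of Hankel matrices, with Hilbert–Schmidt norms bounded by `∑ |m| c_m²`, where `c_m` are the
Fourier coefficients, and this is finite because `f' ∈ L²`. Operator norms of Toeplitz matrices are
bounded by the suprema of the symbols, and those of the inverses by the supremum of the inverse
symbol; hence also `T_n(f)⁻¹` and `T_n(1 / f)` are at bounded trace distance
(`isAsympToeplitz_inv`). So every product `W X W Y ⋯` is a Toeplitz matrix up to bounded trace
norm, its symbol being a product of functions `∂_i S / S` and `∂_i ∂_j S / S`, and its trace is `n`
times the mean of that symbol, up to `O(1)`. Dividing by `n` gives all the expansions.
-/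

noncomputable section

namespace ARMA

/-! ### Partial derivatives and integrals depending on a parameter -/

section PartialDerivatives

variable {k : ℕ} {Θ : Set (Fin k → ℝ)} {θ : Fin k → ℝ}

theorem pd_eq_fderiv {f : (Fin k → ℝ) → ℝ} (hf : DifferentiableAt ℝ f θ) (i : Fin k) :
    pd i f θ = fderiv ℝ f θ (Pi.single i 1) :=
  hf.lineDeriv_eq_fderiv

theorem pd_congr (hΘ : IsOpen Θ) {f g : (Fin k → ℝ) → ℝ} (h : Set.EqOn f g Θ) (hθ : θ ∈ Θ)
    (i : Fin k) : pd i f θ = pd i g θ :=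
  (h.eventuallyEq_of_mem (hΘ.mem_nhds hθ)).lineDeriv_eq

theorem contDiffOn_pd (hΘ : IsOpen Θ) {n : ℕ} {f : (Fin k → ℝ) → ℝ}
    (hf : ContDiffOn ℝ (n + 1) f Θ) (i : Fin k) : ContDiffOn ℝ n (pd i f) Θ := by
  refine ((hf.fderiv_of_isOpen hΘ le_rfl).clm_apply
    (contDiffOn_const (c := Pi.single i (1 : ℝ)))).congr fun θ hθ => ?_
  exact pd_eq_fderiv ((hf.differentiableOn (by simp)).differentiableAt (hΘ.mem_nhds hθ)) i

theorem fderiv_eq_sum_pd {f : (Fin k → ℝ) → ℝ} (hf : DifferentiableAt ℝ f θ) :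
    fderiv ℝ f θ = ∑ i, pd i f θ • (ContinuousLinearMap.proj i : (Fin k → ℝ) →L[ℝ] ℝ) := by
  ext v
  conv_lhs => rw [pi_eq_sum_univ' v, map_sum]
  simp [pd_eq_fderiv hf, mul_comm]

theorem contDiffOn_succ_of_pd (hΘ : IsOpen Θ) {n : ℕ} {f : (Fin k → ℝ) → ℝ}
    (hf : DifferentiableOn ℝ f Θ) (hp : ∀ i, ContDiffOn ℝ n (pd i f) Θ) :
    ContDiffOn ℝ (n + 1) f Θ := by
  rw [contDiffOn_succ_iff_fderiv_of_isOpen hΘ]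
  refine ⟨hf, by simp, ?_⟩
  refine ContDiffOn.congr (f := fun θ => ∑ i, pd i f θ •
    (ContinuousLinearMap.proj i : (Fin k → ℝ) →L[ℝ] ℝ)) ?_ fun θ hθ =>
    fderiv_eq_sum_pd (hf.differentiableAt (hΘ.mem_nhds hθ))
  exact ContDiffOn.sum fun i _ => (hp i).smul contDiffOn_const

variable {F : (Fin k → ℝ) → ℝ → ℝ}

/-- `F` is `n` times continuously differentiable in `(θ, ω)` for `θ ∈ Θ`. -/
def JointlyContDiff (Θ : Set (Fin k → ℝ)) (n : ℕ) (F : (Fin k → ℝ) → ℝ → ℝ) : Prop :=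
  ContDiffOn ℝ n (fun y : (Fin k → ℝ) × ℝ => F y.1 y.2) (Θ ×ˢ Set.univ)

theorem JointlyContDiff.of_le {m n : ℕ} (hF : JointlyContDiff Θ n F) (h : m ≤ n) :
    JointlyContDiff Θ m F :=
  ContDiffOn.of_le hF (by exact_mod_cast h)

theorem JointlyContDiff.apply_right {n : ℕ} (hF : JointlyContDiff Θ n F) (hθ : θ ∈ Θ) :
    ContDiff ℝ n (F θ) := by
  rw [← contDiffOn_univ]
  exact ContDiffOn.comp hF (g := fun y : (Fin k → ℝ) × ℝ => F y.1 y.2) (f := fun ω => (θ, ω))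
    (by fun_prop) fun ω _ => ⟨hθ, trivial⟩

theorem JointlyContDiff.apply_left {n : ℕ} (hF : JointlyContDiff Θ n F) (ω : ℝ) :
    ContDiffOn ℝ n (fun θ => F θ ω) Θ :=
  ContDiffOn.comp hF (g := fun y : (Fin k → ℝ) × ℝ => F y.1 y.2) (f := fun θ => (θ, ω))
    (by fun_prop) fun θ hθ => ⟨hθ, trivial⟩

theorem JointlyContDiff.mul_left {n : ℕ} (hF : JointlyContDiff Θ n F) {w : ℝ → ℝ}
    (hw : ContDiff ℝ n w) : JointlyContDiff Θ n fun θ ω => w ω * F θ ω :=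
  ContDiffOn.mul (hw.comp contDiff_snd).contDiffOn hF

theorem JointlyContDiff.hasFDerivAt (hΘ : IsOpen Θ) (hF : JointlyContDiff Θ 1 F) (hθ : θ ∈ Θ)
    (ω : ℝ) : HasFDerivAt (fun t => F t ω)
      (fderiv ℝ (fun y : (Fin k → ℝ) × ℝ => F y.1 y.2) (θ, ω) ∘L
        ContinuousLinearMap.inl ℝ (Fin k → ℝ) ℝ) θ := by
  have h : DifferentiableAt ℝ (fun y : (Fin k → ℝ) × ℝ => F y.1 y.2) (θ, ω) :=
    (ContDiffOn.differentiableOn hF (by simp)).differentiableAt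
      ((hΘ.prod isOpen_univ).mem_nhds ⟨hθ, trivial⟩)
  exact HasFDerivAt.comp (f := fun t => (t, ω)) (g := fun y : (Fin k → ℝ) × ℝ => F y.1 y.2) θ
    h.hasFDerivAt (hasFDerivAt_prodMk_left θ ω)

theorem JointlyContDiff.pd (hΘ : IsOpen Θ) {n : ℕ} (hF : JointlyContDiff Θ (n + 1) F)
    (i : Fin k) : JointlyContDiff Θ n fun θ ω => pd i (fun t => F t ω) θ := by
  have h : ContDiffOn ℝ n (fderiv ℝ fun y : (Fin k → ℝ) × ℝ => F y.1 y.2) (Θ ×ˢ Set.univ) :=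
    ContDiffOn.fderiv_of_isOpen hF (hΘ.prod isOpen_univ) (by simp)
  refine (h.clm_apply (contDiffOn_const (c := ((Pi.single i 1 : Fin k → ℝ), (0 : ℝ))))).congr ?_
  rintro ⟨θ, ω⟩ ⟨hθ, -⟩
  have h1 := (hF.of_le (Nat.le_add_left 1 n)).hasFDerivAt hΘ hθ ω
  simp [pd_eq_fderiv h1.differentiableAt, h1.fderiv]

theorem JointlyContDiff.hasFDerivAt_integral (hΘ : IsOpen Θ) (hF : JointlyContDiff Θ 1 F)
    (hθ : θ ∈ Θ) (a b : ℝ) : HasFDerivAt (fun t => ∫ ω in a..b, F t ω)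
      (∫ ω in a..b, fderiv ℝ (fun y : (Fin k → ℝ) × ℝ => F y.1 y.2) (θ, ω) ∘L
        ContinuousLinearMap.inl ℝ (Fin k → ℝ) ℝ) θ := by
  have hc : ContinuousOn (fun y : (Fin k → ℝ) × ℝ =>
      fderiv ℝ (fun y : (Fin k → ℝ) × ℝ => F y.1 y.2) y ∘L
        ContinuousLinearMap.inl ℝ (Fin k → ℝ) ℝ) (Θ ×ˢ Set.univ) :=
    (ContDiffOn.continuousOn_fderiv_of_isOpen hF (hΘ.prod isOpen_univ) (by simp)).clm_comp
      continuousOn_const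
  obtain ⟨r, hr, hrΘ⟩ := Metric.nhds_basis_closedBall.mem_iff.1 (hΘ.mem_nhds hθ)
  obtain ⟨C, hC⟩ := ((isCompact_closedBall θ r).prod
    (isCompact_uIcc (a := a) (b := b))).bddAbove_image
    (hc.norm.mono (Set.prod_mono hrΘ (Set.subset_univ _)))
  have hcont : ∀ t ∈ Θ, Continuous (F t) := fun t ht => (hF.apply_right ht).continuous
  refine intervalIntegral.hasFDerivAt_integral_of_dominated_of_fderiv_le
    (F' := fun t ω => fderiv ℝ (fun y : (Fin k → ℝ) × ℝ => F y.1 y.2) (t, ω) ∘L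
        ContinuousLinearMap.inl ℝ (Fin k → ℝ) ℝ) (bound := fun _ => C)
    (Metric.closedBall_mem_nhds θ hr) ?_ ((hcont θ hθ).intervalIntegrable _ _) ?_ ?_
    (by simp) ?_
  · filter_upwards [hΘ.mem_nhds hθ] with t ht using (hcont t ht).aestronglyMeasurable
  · refine Continuous.aestronglyMeasurable ?_
    rw [← continuousOn_univ]
    exact hc.comp (f := fun ω => (θ, ω)) (by fun_prop) fun ω _ => ⟨hθ, trivial⟩
  · refine Eventually.of_forall fun ω hω t ht => hC ⟨(t, ω), ⟨ht, Set.uIoc_subset_uIcc hω⟩, rfl⟩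
  · exact Eventually.of_forall fun ω _ t ht => hF.hasFDerivAt hΘ (hrΘ ht) ω

theorem JointlyContDiff.pd_integral (hΘ : IsOpen Θ) (hF : JointlyContDiff Θ 1 F)
    (hθ : θ ∈ Θ) (a b : ℝ) (i : Fin k) :
    ARMA.pd i (fun t => ∫ ω in a..b, F t ω) θ = ∫ ω in a..b, ARMA.pd i (fun t => F t ω) θ := by
  have h := hF.hasFDerivAt_integral hΘ hθ a b
  have hc : Continuous fun ω : ℝ => fderiv ℝ (fun y : (Fin k → ℝ) × ℝ => F y.1 y.2) (θ, ω) ∘L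
        ContinuousLinearMap.inl ℝ (Fin k → ℝ) ℝ := by
    rw [← continuousOn_univ]
    refine ContinuousOn.clm_comp (ContinuousOn.comp
      (ContDiffOn.continuousOn_fderiv_of_isOpen hF (hΘ.prod isOpen_univ) (by simp))
      (f := fun ω => (θ, ω)) (by fun_prop) fun ω _ => ⟨hθ, trivial⟩) continuousOn_const
  rw [pd_eq_fderiv h.differentiableAt, h.fderiv,
    ContinuousLinearMap.intervalIntegral_apply (hc.intervalIntegrable _ _)]
  refine intervalIntegral.integral_congr fun ω _ => ?_
  have h1 := hF.hasFDerivAt hΘ hθ ω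
  simp [pd_eq_fderiv h1.differentiableAt, h1.fderiv]

/-- Smoothness of a parametric integral. The induction differentiates in one coordinate direction
at a time, so that the integrands stay real-valued. -/
theorem JointlyContDiff.contDiffOn_integral (hΘ : IsOpen Θ) (a b : ℝ) {n : ℕ}
    (hF : JointlyContDiff Θ n F) : ContDiffOn ℝ n (fun t => ∫ ω in a..b, F t ω) Θ := by
  induction n generalizing F with
  | zero =>
    refine contDiffOn_zero.2 (continuousOn_iff_continuous_domRestrict.2 ?_)
    refine intervalIntegral.continuous_parametric_intervalIntegral_of_continuous'
      (f := fun (t : Θ) ω => F t ω) ?_ a b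
    have h := contDiffOn_zero.1 hF
    rw [← continuousOn_univ]
    exact h.comp (f := fun y : Θ × ℝ => (y.1.1, y.2)) (by fun_prop) fun y _ => ⟨y.1.2, trivial⟩
  | succ n ih =>
    have h1 := hF.of_le (Nat.le_add_left 1 n)
    refine contDiffOn_succ_of_pd hΘ (fun θ hθ =>
      (h1.hasFDerivAt_integral hΘ hθ a b).differentiableAt.differentiableWithinAt) fun i => ?_
    exact (ih (hF.pd hΘ i)).congr fun θ hθ => h1.pd_integral hΘ hθ a b i

end PartialDerivatives

/-! ### Second and fourth moments of Gaussian vectors -/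

section GaussianMoments

open scoped NNReal

theorem integral_pow_four_gaussianReal (v : ℝ≥0) :
    ∫ x, x ^ 4 ∂(gaussianReal 0 v) = 3 * (v : ℝ) ^ 2 := by
  have h := iteratedDeriv_mgf_zero (X := id) (μ := gaussianReal 0 v)
    (by simp [integrableExpSet_id_gaussianReal]) 4
  have hE : ∀ t : ℝ, HasDerivAt (fun t : ℝ => Real.exp (v * t ^ 2 / 2))
      (v * t * Real.exp (v * t ^ 2 / 2)) t := fun t => by
    have h1 : HasDerivAt (fun t : ℝ => (v : ℝ) * t ^ 2 / 2) (v * t) t :=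
      (((hasDerivAt_pow 2 t).const_mul (v : ℝ)).div_const 2).congr_deriv (by push_cast; ring)
    exact h1.exp.congr_deriv (mul_comm _ _)
  -- each derivative of the moment generating function is a polynomial times itself
  have hP : ∀ p : Polynomial ℝ, deriv (fun t => p.eval t * Real.exp (v * t ^ 2 / 2)) =
      fun t => (Polynomial.derivative p + p * (Polynomial.C (v : ℝ) * Polynomial.X)).eval t *
        Real.exp (v * t ^ 2 / 2) := fun p => by
    ext t
    refine ((p.hasDerivAt t).mul (hE t)).deriv.trans ?_
    simp only [Polynomial.eval_add, Polynomial.eval_mul, Polynomial.eval_C, Polynomial.eval_X]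
    ring
  -- so that the fourth one at `0` is the value of a polynomial
  have h0 : mgf id (gaussianReal 0 v) =
      fun t => (1 : Polynomial ℝ).eval t * Real.exp (v * t ^ 2 / 2) := by
    rw [mgf_id_gaussianReal]; ext t; simp
  rw [h0] at h
  simp only [iteratedDeriv_succ', iteratedDeriv_zero, hP] at h
  simp only [id, Pi.pow_apply] at h
  rw [← h]
  simp
  ring

variable {E : Type*} [NormedAddCommGroup E] [NormedSpace ℝ E] [MeasurableSpace E] [BorelSpace E]
  {μ : Measure E} [IsGaussian μ]

theorem integrable_dual_mul (a b : StrongDual ℝ E) : Integrable (fun x => a x * b x) μ :=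
  (IsGaussian.memLp_dual μ a 2 (by simp)).integrable_mul (IsGaussian.memLp_dual μ b 2 (by simp))

theorem integrable_dual_mul_mul_mul (a b c d : StrongDual ℝ E) :
    Integrable (fun x => a x * b x * (c x * d x)) μ := by
  have h : ∀ a b : StrongDual ℝ E, MemLp (fun x => a x * b x) 2 μ := fun a b =>
    have : ENNReal.HolderTriple 4 4 2 := ⟨by
      rw [← two_mul, show (4 : ENNReal) = 2 * 2 by norm_num, ENNReal.mul_inv (by simp) (by simp),
        ← mul_assoc, ENNReal.mul_inv_cancel (by simp) (by simp), one_mul]⟩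
    (IsGaussian.memLp_dual μ b 4 (by simp)).mul (IsGaussian.memLp_dual μ a 4 (by simp))
  exact (h a b).integrable_mul (h c d)

variable [CompleteSpace E] [SecondCountableTopology E]

theorem integral_dual_pow_four (hμ : ∫ x, x ∂μ = 0) (a : StrongDual ℝ E) :
    ∫ x, a x ^ 4 ∂μ = 3 * (∫ x, a x * a x ∂μ) ^ 2 := by
  have h0 : ∫ x, a x ∂μ = 0 := by
    rw [IsGaussian.integral_dual, hμ, map_zero]
  have hv : Var[a; μ] = ∫ x, a x * a x ∂μ := by
    rw [variance_of_integral_eq_zero (by fun_prop) h0]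
    simp [sq]
  have h := IsGaussian.map_eq_gaussianReal (μ := μ) a
  rw [h0, hv] at h
  have h1 := integral_pow_four_gaussianReal (∫ x, a x * a x ∂μ).toNNReal
  rw [← h, integral_map (by fun_prop) (by fun_prop),
    Real.coe_toNNReal _ (integral_nonneg fun x => mul_self_nonneg _)] at h1
  exact h1

/-- **Isserlis' theorem** for four linear functionals of a centred Gaussian vector. It follows from
the fourth moments of single functionals by polarization. -/
theorem integral_dual_mul_mul_mul (hμ : ∫ x, x ∂μ = 0) (a b c d : StrongDual ℝ E) :
    ∫ x, a x * b x * (c x * d x) ∂μ =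
      (∫ x, a x * b x ∂μ) * (∫ x, c x * d x ∂μ) + (∫ x, a x * c x ∂μ) * (∫ x, b x * d x ∂μ) +
      (∫ x, a x * d x ∂μ) * (∫ x, b x * c x ∂μ) := by
  have key : ∀ s t u : ℝ, ∫ x, (a x + s * b x + t * c x + u * d x) ^ 4 ∂μ =
      3 * ((∫ x, a x * a x ∂μ) + s ^ 2 * (∫ x, b x * b x ∂μ) + t ^ 2 * (∫ x, c x * c x ∂μ) +
        u ^ 2 * (∫ x, d x * d x ∂μ) + 2 * s * (∫ x, a x * b x ∂μ) + 2 * t * (∫ x, a x * c x ∂μ) +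
        2 * u * (∫ x, a x * d x ∂μ) + 2 * s * t * (∫ x, b x * c x ∂μ) +
        2 * s * u * (∫ x, b x * d x ∂μ) + 2 * t * u * (∫ x, c x * d x ∂μ)) ^ 2 := fun s t u => by
    have h := integral_dual_pow_four hμ (a + s • b + t • c + u • d)
    simp only [_root_.add_apply, _root_.smul_apply, smul_eq_mul] at h
    rw [h]
    congr 2
    simp only [← integral_const_mul]
    have i := fun (r : ℝ) (a b : StrongDual ℝ E) => (integrable_dual_mul (μ := μ) a b).const_mul r
    have i1 := fun (a b : StrongDual ℝ E) => integrable_dual_mul (μ := μ) a b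
    rw [← integral_add, ← integral_add, ← integral_add, ← integral_add, ← integral_add,
      ← integral_add, ← integral_add, ← integral_add, ← integral_add]
    · exact integral_congr_ae (Eventually.of_forall fun x => by ring)
    all_goals first | exact i _ _ _ | skip
    all_goals repeat' first | exact i1 _ _ | exact i _ _ _ | apply Integrable.add
  have i4 : ∀ s t u : ℝ, Integrable (fun x => (a x + s * b x + t * c x + u * d x) ^ 4) μ :=
    fun s t u => by
    have h := integrable_dual_mul_mul_mul (μ := μ) (a + s • b + t • c + u • d)
      (a + s • b + t • c + u • d) (a + s • b + t • c + u • d) (a + s • b + t • c + u • d)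
    simp only [_root_.add_apply, _root_.smul_apply, smul_eq_mul] at h
    exact h.congr (Eventually.of_forall fun x => by ring)
  -- the eight powers `(a ± b ± c ± d) ^ 4`, weighted with the product of the signs, add up to
  -- `192 * a * b * c * d`
  have hsum : 192 * ∫ x, a x * b x * (c x * d x) ∂μ =
      ((∫ x, (a x + 1 * b x + 1 * c x + 1 * d x) ^ 4 ∂μ) -
      ∫ x, (a x + 1 * b x + 1 * c x + (-1) * d x) ^ 4 ∂μ) -
      ((∫ x, (a x + 1 * b x + (-1) * c x + 1 * d x) ^ 4 ∂μ) -
      ∫ x, (a x + 1 * b x + (-1) * c x + (-1) * d x) ^ 4 ∂μ) -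
      (((∫ x, (a x + (-1) * b x + 1 * c x + 1 * d x) ^ 4 ∂μ) -
      ∫ x, (a x + (-1) * b x + 1 * c x + (-1) * d x) ^ 4 ∂μ) -
      ((∫ x, (a x + (-1) * b x + (-1) * c x + 1 * d x) ^ 4 ∂μ) -
      ∫ x, (a x + (-1) * b x + (-1) * c x + (-1) * d x) ^ 4 ∂μ)) := by
    rw [← integral_sub, ← integral_sub, ← integral_sub, ← integral_sub, ← integral_sub,
      ← integral_sub, ← integral_sub, ← integral_const_mul]
    · exact integral_congr_ae (Eventually.of_forall fun x => by ring)
    all_goals repeat' first | exact i4 _ _ _ | apply Integrable.sub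
  simp only [key] at hsum
  linear_combination hsum / 192

end GaussianMoments

section QuadraticForms

variable {ι : Type*} [Fintype ι] {C : Matrix ι ι ℝ}

theorem integrable_coord_mul (μ : Measure (EuclideanSpace ℝ ι)) [IsGaussian μ] (a b : ι) :
    Integrable (fun x => x a * x b) μ :=
  integrable_dual_mul (EuclideanSpace.proj a) (EuclideanSpace.proj b)

theorem integrable_coord_mul_mul_mul (μ : Measure (EuclideanSpace ℝ ι)) [IsGaussian μ]
    (a b c d : ι) : Integrable (fun x => x a * x b * (x c * x d)) μ :=
  integrable_dual_mul_mul_mul (EuclideanSpace.proj a) (EuclideanSpace.proj b)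
    (EuclideanSpace.proj c) (EuclideanSpace.proj d)

theorem dotProduct_mulVec_eq_sum (A : Matrix ι ι ℝ) (x : ι → ℝ) :
    x ⬝ᵥ (A *ᵥ x) = ∑ p : ι × ι, A p.1 p.2 * (x p.1 * x p.2) := by
  simp only [dotProduct, mulVec, Finset.mul_sum, Fintype.sum_prod_type]
  exact Finset.sum_congr rfl fun _ _ => Finset.sum_congr rfl fun _ _ => by ring

theorem integrable_quadraticForm (A : Matrix ι ι ℝ) (μ : Measure (EuclideanSpace ℝ ι))
    [IsGaussian μ] : Integrable (fun x => x.ofLp ⬝ᵥ (A *ᵥ x.ofLp)) μ := by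
  simp only [dotProduct_mulVec_eq_sum]
  exact integrable_finsetSum _ fun p _ => (integrable_coord_mul μ _ _).const_mul _

theorem integrable_quadraticForm_mul (A B : Matrix ι ι ℝ) (μ : Measure (EuclideanSpace ℝ ι))
    [IsGaussian μ] :
    Integrable (fun x => x.ofLp ⬝ᵥ (A *ᵥ x.ofLp) * (x.ofLp ⬝ᵥ (B *ᵥ x.ofLp))) μ := by
  simp only [dotProduct_mulVec_eq_sum, Finset.sum_mul_sum]
  refine integrable_finsetSum _ fun p _ => integrable_finsetSum _ fun q _ => ?_
  exact ((integrable_coord_mul_mul_mul μ p.1 p.2 q.1 q.2).const_mul (A p.1 p.2 * B q.1 q.2)).congr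
    (Eventually.of_forall fun x => by ring)

variable [DecidableEq ι]

theorem integral_coord_mul (hC : C.PosSemidef) (a b : ι) :
    ∫ x, x a * x b ∂(multivariateGaussian 0 C) = C a b := by
  have h0 : ∀ a : ι, ∫ x, x a ∂(multivariateGaussian 0 C) = 0 := fun a => by
    have := IsGaussian.integral_dual (μ := multivariateGaussian 0 C) (EuclideanSpace.proj a)
    simpa using this
  have h := covariance_eval_multivariateGaussian (μ := 0) hC a b
  rw [covariance, h0, h0] at h
  simpa using h

theorem integral_coord_mul_mul_mul (hC : C.PosSemidef) (a b c d : ι) :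
    ∫ x, x a * x b * (x c * x d) ∂(multivariateGaussian 0 C) =
      C a b * C c d + C a c * C b d + C a d * C b c := by
  have h := integral_dual_mul_mul_mul (μ := multivariateGaussian 0 C) (by simp)
    (EuclideanSpace.proj a) (EuclideanSpace.proj b) (EuclideanSpace.proj c)
    (EuclideanSpace.proj d)
  simp only [PiLp.proj_apply, integral_coord_mul hC] at h
  exact h

theorem integral_quadraticForm (hC : C.PosSemidef) (A : Matrix ι ι ℝ) :
    ∫ x, x.ofLp ⬝ᵥ (A *ᵥ x.ofLp) ∂(multivariateGaussian 0 C) = (A * C).trace := by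
  simp only [dotProduct_mulVec_eq_sum]
  refine (integral_finsetSum _ fun p _ => (integrable_coord_mul
    (multivariateGaussian 0 C) p.1 p.2).const_mul (A p.1 p.2)).trans ?_
  simp only [integral_const_mul, integral_coord_mul hC, Fintype.sum_prod_type, trace, diag,
    mul_apply]
  exact Finset.sum_congr rfl fun a _ => Finset.sum_congr rfl fun b _ => by
    rw [← hC.1.apply b a]; simp

/-- The second moment of a pair of quadratic forms in a centred Gaussian vector. -/
theorem integral_quadraticForm_mul (hC : C.PosSemidef) (A : Matrix ι ι ℝ) {B : Matrix ι ι ℝ}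
    (hB : B.IsSymm) :
    ∫ x, x.ofLp ⬝ᵥ (A *ᵥ x.ofLp) * (x.ofLp ⬝ᵥ (B *ᵥ x.ofLp)) ∂(multivariateGaussian 0 C) =
      (A * C).trace * (B * C).trace + 2 * (A * C * B * C).trace := by
  have hs : ∀ a b, C a b = C b a := fun a b => by rw [← hC.1.apply b a]; simp
  have hBs : ∀ a b, B a b = B b a := fun a b => hB.apply b a
  simp only [dotProduct_mulVec_eq_sum, Finset.sum_mul_sum]
  have e : ∀ (p q : ι × ι) (x : EuclideanSpace ℝ ι),
      A p.1 p.2 * (x.ofLp p.1 * x.ofLp p.2) * (B q.1 q.2 * (x.ofLp q.1 * x.ofLp q.2)) =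
      A p.1 p.2 * B q.1 q.2 * (x p.1 * x p.2 * (x q.1 * x q.2)) := fun p q x => by ring
  simp only [e]
  refine (integral_finsetSum _ fun p _ => integrable_finsetSum _ fun q _ =>
    (integrable_coord_mul_mul_mul
    (multivariateGaussian 0 C) p.1 p.2 q.1 q.2).const_mul (A p.1 p.2 * B q.1 q.2)).trans ?_
  have e2 : ∀ p : ι × ι, ∫ x : EuclideanSpace ℝ ι, ∑ q : ι × ι,
      A p.1 p.2 * B q.1 q.2 * (x p.1 * x p.2 * (x q.1 * x q.2)) ∂(multivariateGaussian 0 C) =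
      ∑ q : ι × ι, A p.1 p.2 * B q.1 q.2 *
        (C p.1 p.2 * C q.1 q.2 + C p.1 q.1 * C p.2 q.2 + C p.1 q.2 * C p.2 q.1) := fun p => by
    refine (integral_finsetSum _ fun q _ =>
      (integrable_coord_mul_mul_mul
    (multivariateGaussian 0 C) p.1 p.2 q.1 q.2).const_mul (A p.1 p.2 * B q.1 q.2)).trans ?_
    simp only [integral_const_mul, integral_coord_mul_mul_mul hC]
  simp only [e2]
  have t1 : (A * C).trace * (B * C).trace =
      ∑ p : ι × ι, ∑ q : ι × ι, A p.1 p.2 * B q.1 q.2 * (C p.1 p.2 * C q.1 q.2) := by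
    have h : ∀ A : Matrix ι ι ℝ, (A * C).trace = ∑ p : ι × ι, A p.1 p.2 * C p.1 p.2 := fun A => by
      simp only [Fintype.sum_prod_type, trace, diag, mul_apply]
      exact Finset.sum_congr rfl fun a _ => Finset.sum_congr rfl fun b _ => by rw [hs]
    rw [h, h, Finset.sum_mul_sum]
    exact Finset.sum_congr rfl fun p _ => Finset.sum_congr rfl fun q _ => by ring
  have t2 : (A * C * B * C).trace =
      ∑ p : ι × ι, ∑ q : ι × ι, A p.1 p.2 * B q.1 q.2 * (C p.1 q.2 * C p.2 q.1) := by
    simp only [Matrix.mul_assoc]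
    simp only [trace, diag, mul_apply, Finset.mul_sum, Fintype.sum_prod_type]
    refine Finset.sum_congr rfl fun a _ => Finset.sum_congr rfl fun b _ =>
      Finset.sum_congr rfl fun c _ => Finset.sum_congr rfl fun d _ => ?_
    rw [hs a d]
    ring
  have t3 : (A * C * B * C).trace =
      ∑ p : ι × ι, ∑ q : ι × ι, A p.1 p.2 * B q.1 q.2 * (C p.1 q.1 * C p.2 q.2) := by
    rw [t2]
    refine Finset.sum_congr rfl fun p _ => ?_
    refine Fintype.sum_equiv (Equiv.prodComm ι ι) _ _ fun q => ?_
    simp [hBs q.1 q.2]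
  rw [two_mul, t1]
  nth_rw 1 [t3]
  rw [t2]
  simp only [← Finset.sum_add_distrib]
  exact Finset.sum_congr rfl fun p _ => Finset.sum_congr rfl fun q _ => by ring

end QuadraticForms

/-! ### Fourier coefficients of even functions -/

/-- The `m`-th Fourier coefficient `(2π)⁻¹ ∫ cos (m ω) f(ω) dω` of an even function `f`. -/
def cosCoeff (f : ℝ → ℝ) (m : ℤ) : ℝ := (2 * π)⁻¹ * ∫ ω in (-π)..π, Real.cos (m * ω) * f ω

theorem neg_pi_lt_pi : -π < π := by linarith [Real.pi_pos]

theorem cosCoeff_neg (f : ℝ → ℝ) (m : ℤ) : cosCoeff f (-m) = cosCoeff f m := by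
  simp [cosCoeff]

theorem integral_odd_eq_zero {f : ℝ → ℝ} (hf : ∀ x, f (-x) = -f x) (a : ℝ) :
    ∫ x in (-a)..a, f x = 0 := by
  have h := intervalIntegral.integral_comp_neg (a := -a) (b := a) f
  simp only [hf, intervalIntegral.integral_neg, neg_neg] at h
  linarith

theorem cosCoeff_one (m : ℤ) : cosCoeff (fun _ => 1) m = if m = 0 then 1 else 0 := by
  split_ifs with h
  · simp [cosCoeff, h]
    field_simp
    ring
  · have h' : (m : ℝ) ≠ 0 := by exact_mod_cast h
    simp [cosCoeff, intervalIntegral.integral_comp_mul_left (fun x => Real.cos x) h',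
      integral_cos, Real.sin_int_mul_pi]

/-- The complex Fourier coefficients of `f(ω) exp (i s ω)` in terms of cosine and sine integrals
of `f`. The frequency `s` is included because Parseval's identity will be applied to such
products. -/
theorem fourierCoeffOn_eq_sum (f : ℝ → ℝ) (hf : Continuous f) (s r : ℤ) :
    fourierCoeffOn neg_pi_lt_pi (fun ω => (f ω : ℂ) * Complex.exp (s * ω * Complex.I)) r =
      (cosCoeff f (s - r) : ℂ) +
      ((2 * π)⁻¹ * ∫ ω in (-π)..π, Real.sin ((s - r : ℤ) * ω) * f ω : ℝ) * Complex.I := by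
  rw [fourierCoeffOn_eq_integral]
  have e : ∀ x : ℝ, fourier (-r) (x : AddCircle (π - -π)) •
      ((f x : ℂ) * Complex.exp (s * x * Complex.I)) =
      ((Real.cos ((s - r : ℤ) * x) * f x : ℝ) : ℂ) +
      ((Real.sin ((s - r : ℤ) * x) * f x : ℝ) : ℂ) * Complex.I := fun x => by
    rw [fourier_coe_apply, smul_eq_mul, mul_left_comm, ← Complex.exp_add]
    have : 2 * (π : ℂ) * Complex.I * (-r : ℤ) * x / (π - -π : ℝ) + s * x * Complex.I =
        (((s - r : ℤ) * x : ℝ) : ℂ) * Complex.I := by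
      have hp : (π : ℂ) ≠ 0 := by exact_mod_cast Real.pi_ne_zero
      push_cast
      field_simp
      ring
    rw [this, Complex.exp_mul_I]
    push_cast
    ring
  simp only [e]
  have hc : Continuous fun x => Real.cos ((s - r : ℤ) * x) * f x := by fun_prop
  have hs : Continuous fun x => Real.sin ((s - r : ℤ) * x) * f x := by fun_prop
  rw [intervalIntegral.integral_add, intervalIntegral.integral_mul_const,
    intervalIntegral.integral_ofReal, intervalIntegral.integral_ofReal, cosCoeff]
  · rw [Complex.real_smul]
    push_cast
    ring
  · exact (Complex.continuous_ofReal.comp hc).intervalIntegrable _ _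
  · exact ((Complex.continuous_ofReal.comp hs).mul continuous_const).intervalIntegrable _ _

theorem fourierCoeffOn_of_even {f : ℝ → ℝ} (hf : Continuous f) (he : ∀ x, f (-x) = f x)
    (s r : ℤ) :
    fourierCoeffOn neg_pi_lt_pi (fun ω => (f ω : ℂ) * Complex.exp (s * ω * Complex.I)) r =
      (cosCoeff f (s - r) : ℂ) := by
  rw [fourierCoeffOn_eq_sum f hf, integral_odd_eq_zero (fun x => by simp [he])]
  simp

theorem memLp_two_of_continuous {f : ℝ → ℂ} (hf : Continuous f) (a b : ℝ) :
    MemLp f 2 (volume.restrict (Set.Ioc a b)) := by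
  obtain ⟨C, hC⟩ := (isCompact_Icc (a := a) (b := b)).exists_bound_of_continuousOn hf.continuousOn
  refine MemLp.of_bound hf.aestronglyMeasurable C ?_
  exact (ae_restrict_iff' measurableSet_Ioc).2 (Eventually.of_forall fun x hx =>
    hC x (Set.Ioc_subset_Icc_self hx))

/-- The convolution formula for the coefficients of a product: Parseval's identity for the functions
`f(ω) exp (i s ω)` and `g(ω) exp (i t ω)`, polarized. -/
theorem hasSum_cosCoeff_mul {f g : ℝ → ℝ} (hf : Continuous f) (hg : Continuous g)
    (hfe : ∀ x, f (-x) = f x) (hge : ∀ x, g (-x) = g x) (s t : ℤ) :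
    HasSum (fun r : ℤ => cosCoeff f (s - r) * cosCoeff g (r - t))
      (cosCoeff (fun ω => f ω * g ω) (s - t)) := by
  have key : ∀ ε : ℝ, HasSum (fun r : ℤ => (cosCoeff f (s - r) + ε * cosCoeff g (t - r)) ^ 2)
      ((2 * π)⁻¹ * ∫ x in (-π)..π,
        (f x ^ 2 + ε ^ 2 * g x ^ 2 + 2 * ε * (Real.cos ((s - t : ℤ) * x) * (f x * g x)))) := by
    intro ε
    let F : ℝ → ℂ := fun ω => (f ω : ℂ) * Complex.exp (s * ω * Complex.I)
    let G : ℝ → ℂ := fun ω => (g ω : ℂ) * Complex.exp (t * ω * Complex.I)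
    have hF : Continuous F := by fun_prop
    have hG : Continuous G := by fun_prop
    have hc : ∀ r, fourierCoeffOn neg_pi_lt_pi (fun ω => F ω + ε * G ω) r =
        ((cosCoeff f (s - r) + ε * cosCoeff g (t - r) : ℝ) : ℂ) := fun r => by
      push_cast
      rw [← fourierCoeffOn_of_even hf hfe, ← fourierCoeffOn_of_even hg hge,
        fourierCoeffOn_eq_integral, fourierCoeffOn_eq_integral, fourierCoeffOn_eq_integral]
      simp only [smul_add]
      have c1 : Continuous fun x : ℝ => fourier (-r) (x : AddCircle (π - -π)) :=
        (fourier (-r)).continuous.comp (AddCircle.continuous_mk' _)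
      rw [intervalIntegral.integral_add, smul_add]
      · congr 1
        rw [mul_smul_comm, ← intervalIntegral.integral_const_mul]
        simp only [smul_eq_mul, mul_left_comm, G]
      · exact (c1.smul hF).intervalIntegrable _ _
      · exact (c1.smul (continuous_const.mul hG)).intervalIntegrable _ _
    have hn : ∀ x : ℝ, ‖F x + ε * G x‖ ^ 2 = f x ^ 2 + ε ^ 2 * g x ^ 2 +
        2 * ε * (Real.cos ((s - t : ℤ) * x) * (f x * g x)) := fun x => by
      have e1 : F x + ε * G x = ((f x * Real.cos (s * x) + ε * (g x * Real.cos (t * x)) : ℝ) : ℂ) +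
          ((f x * Real.sin (s * x) + ε * (g x * Real.sin (t * x)) : ℝ) : ℂ) * Complex.I := by
        simp only [F, G, Complex.exp_mul_I]
        push_cast
        ring
      rw [e1, ← Complex.normSq_eq_norm_sq, Complex.normSq_add_mul_I]
      push_cast
      rw [sub_mul, Real.cos_sub]
      linear_combination f x ^ 2 * Real.sin_sq_add_cos_sq (s * x) +
        ε ^ 2 * g x ^ 2 * Real.sin_sq_add_cos_sq (t * x)
    have h := hasSum_sq_fourierCoeffOn neg_pi_lt_pi
      (memLp_two_of_continuous (show Continuous fun ω => F ω + ε * G ω by fun_prop) (-π) π)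
    simp only [hc, hn, Complex.norm_real, Real.norm_eq_abs, sq_abs, smul_eq_mul] at h
    rwa [show (π - -π) = 2 * π by ring] at h
  have h := ((key 1).sub (key (-1))).mul_left (1 / 4)
  convert! h using 1
  · funext r
    rw [← cosCoeff_neg g (r - t), neg_sub]
    ring
  · rw [← mul_sub, ← intervalIntegral.integral_sub, cosCoeff,
      mul_left_comm (1 / 4 : ℝ), ← intervalIntegral.integral_const_mul (1 / 4 : ℝ)]
    · congr 1
      exact intervalIntegral.integral_congr fun x _ => by ring
    all_goals exact Continuous.intervalIntegrable (by fun_prop) _ _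

/-- By parts, `m c_m` is a sine coefficient of `f'`, and Bessel's inequality applies. No boundary
terms occur, because `sin (m ω)` vanishes at `±π`; so `f` need not be periodic. -/
theorem summable_sq_mul_cosCoeff_sq {f : ℝ → ℝ} (hf : ContDiff ℝ 1 f) :
    Summable fun m : ℤ => (m : ℝ) ^ 2 * cosCoeff f m ^ 2 := by
  have hd : Continuous (deriv f) := hf.continuous_deriv le_rfl
  have h := (hasSum_sq_fourierCoeffOn neg_pi_lt_pi (memLp_two_of_continuous
    (f := fun ω => ((deriv f ω : ℝ) : ℂ) * Complex.exp ((0 : ℤ) * ω * Complex.I))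
    (by fun_prop) (-π) π)).summable
  refine Summable.of_nonneg_of_le (fun m => by positivity) (fun m => ?_) h
  have hp : ∫ ω in (-π)..π, f ω * (Real.cos (m * ω) * m) =
      - ∫ ω in (-π)..π, deriv f ω * Real.sin (m * ω) := by
    rw [intervalIntegral.integral_mul_deriv_eq_deriv_mul (u := f) (v := fun ω => Real.sin (m * ω))
      (u' := deriv f) (fun x _ => (hf.differentiable one_ne_zero x).hasDerivAt)
      (fun x _ => by simpa using ((hasDerivAt_id x).const_mul (m : ℝ)).sin)
      (hd.intervalIntegrable _ _)
      ((by fun_prop : Continuous fun ω : ℝ => Real.cos (m * ω) * m).intervalIntegrable _ _)]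
    simp [Real.sin_int_mul_pi]
  have e : (m : ℝ) * cosCoeff f m = (fourierCoeffOn neg_pi_lt_pi (fun ω => ((deriv f ω : ℝ) : ℂ) *
      Complex.exp ((0 : ℤ) * ω * Complex.I)) m).im := by
    rw [fourierCoeffOn_eq_sum _ hd]
    simp only [Complex.add_im, Complex.ofReal_im, Complex.mul_im, Complex.ofReal_re, Complex.I_im,
      Complex.I_re, mul_one, mul_zero, add_zero, zero_add, cosCoeff]
    rw [mul_left_comm]
    congr 1
    rw [← intervalIntegral.integral_const_mul]
    trans ∫ ω in (-π)..π, f ω * (Real.cos (m * ω) * m)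
    · exact intervalIntegral.integral_congr fun x _ => by ring
    · rw [hp, ← intervalIntegral.integral_neg]
      refine intervalIntegral.integral_congr fun x _ => ?_
      simp
      ring
  rw [← mul_pow, e]
  exact sq_le_sq' (neg_le_of_abs_le (Complex.abs_im_le_norm _)) (Complex.im_le_norm _)

/-! ### Toeplitz matrices and their products -/

section Toeplitz

open scoped Matrix.Norms.L2Operator

/-- The symbols for which products of Toeplitz matrices are controlled: even `C¹` functions. -/
structure IsSymbol (f : ℝ → ℝ) : Prop where
  contDiff : ContDiff ℝ 1 f
  even : ∀ ω, f (-ω) = f ω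

theorem IsSymbol.continuous {f : ℝ → ℝ} (hf : IsSymbol f) : Continuous f := hf.contDiff.continuous

theorem IsSymbol.mul {f g : ℝ → ℝ} (hf : IsSymbol f) (hg : IsSymbol g) :
    IsSymbol fun ω => f ω * g ω :=
  ⟨hf.contDiff.mul hg.contDiff, fun ω => by rw [hf.even, hg.even]⟩

theorem IsSymbol.inv {f : ℝ → ℝ} (hf : IsSymbol f) (h : ∀ ω, f ω ≠ 0) :
    IsSymbol fun ω => (f ω)⁻¹ :=
  ⟨hf.contDiff.inv h, fun ω => by rw [hf.even]⟩

theorem IsSymbol.const_mul {f : ℝ → ℝ} (hf : IsSymbol f) (c : ℝ) : IsSymbol fun ω => c * f ω :=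
  ⟨contDiff_const.mul hf.contDiff, fun ω => by rw [hf.even]⟩

/-- The `n × n` Toeplitz matrix of the coefficients of `f`, normalized so that the symbol `1` gives
the identity matrix. -/
def toeplitz (f : ℝ → ℝ) (n : ℕ) : Matrix (Fin n) (Fin n) ℝ :=
  Matrix.of fun s t => cosCoeff f ((s.val : ℤ) - t.val)

theorem toeplitz_one (n : ℕ) : toeplitz (fun _ => 1) n = 1 := by
  ext s t
  simp [toeplitz, cosCoeff_one, sub_eq_zero, one_apply, Fin.ext_iff]

theorem trace_toeplitz (f : ℝ → ℝ) (n : ℕ) : (toeplitz f n).trace = n * cosCoeff f 0 := by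
  simp [toeplitz, trace]

variable {n : ℕ} {f g : ℝ → ℝ}

/-- The bilinear form of a Toeplitz matrix, by means of the trigonometric polynomials with the
given coefficients. -/
theorem dotProduct_toeplitz_mulVec (hf : Continuous f) (x y : Fin n → ℝ) :
    x ⬝ᵥ (toeplitz f n *ᵥ y) = (2 * π)⁻¹ * ∫ ω in (-π)..π, f ω *
      ((∑ s, x s * Real.cos (s.val * ω)) * (∑ s, y s * Real.cos (s.val * ω)) +
        (∑ s, x s * Real.sin (s.val * ω)) * (∑ s, y s * Real.sin (s.val * ω))) := by
  have e : ∀ ω : ℝ, f ω * ((∑ s, x s * Real.cos (s.val * ω)) * (∑ s, y s * Real.cos (s.val * ω)) +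
        (∑ s, x s * Real.sin (s.val * ω)) * (∑ s, y s * Real.sin (s.val * ω))) =
      ∑ s, ∑ t, x s * y t * (Real.cos (((s.val : ℤ) - t.val : ℤ) * ω) * f ω) := fun ω => by
    rw [Finset.sum_mul_sum, Finset.sum_mul_sum, ← Finset.sum_add_distrib, Finset.mul_sum]
    refine Finset.sum_congr rfl fun s _ => ?_
    rw [← Finset.sum_add_distrib, Finset.mul_sum]
    refine Finset.sum_congr rfl fun t _ => ?_
    push_cast
    rw [sub_mul, Real.cos_sub]
    ring
  simp only [e]
  rw [intervalIntegral.integral_finsetSum, Finset.mul_sum]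
  · refine Finset.sum_congr rfl fun s _ => ?_
    rw [intervalIntegral.integral_finsetSum]
    · simp only [toeplitz, cosCoeff, mulVec, dotProduct, intervalIntegral.integral_const_mul,
        Finset.mul_sum, of_apply]
      exact Finset.sum_congr rfl fun t _ => by ring
    · exact fun t _ => Continuous.intervalIntegrable (by fun_prop) _ _
  · exact fun s _ => Continuous.intervalIntegrable (by fun_prop) _ _

theorem dotProduct_self_eq_integral (x : Fin n → ℝ) :
    x ⬝ᵥ x = (2 * π)⁻¹ * ∫ ω in (-π)..π, ((∑ s, x s * Real.cos (s.val * ω)) ^ 2 +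
        (∑ s, x s * Real.sin (s.val * ω)) ^ 2) := by
  have h := dotProduct_toeplitz_mulVec (f := fun _ => 1) continuous_const x x
  rw [toeplitz_one, one_mulVec] at h
  rw [h]
  congr 1
  exact intervalIntegral.integral_congr fun ω _ => by ring

theorem le_dotProduct_toeplitz_mulVec {m : ℝ} (hf : Continuous f)
    (hm : ∀ ω ∈ Set.Icc (-π) π, m ≤ f ω) (x : Fin n → ℝ) :
    m * (x ⬝ᵥ x) ≤ x ⬝ᵥ (toeplitz f n *ᵥ x) := by
  rw [dotProduct_toeplitz_mulVec hf, dotProduct_self_eq_integral, mul_left_comm,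
    ← intervalIntegral.integral_const_mul]
  refine mul_le_mul_of_nonneg_left ?_ (show (0 : ℝ) ≤ (2 * π)⁻¹ by positivity)
  refine intervalIntegral.integral_mono_on neg_pi_lt_pi.le
    (Continuous.intervalIntegrable (by fun_prop) _ _)
    (Continuous.intervalIntegrable (by fun_prop) _ _) fun ω hω => ?_
  rw [← sq, ← sq]
  exact mul_le_mul_of_nonneg_right (hm ω hω) (by positivity)

theorem dotProduct_toeplitz_mulVec_le {M : ℝ} (hf : Continuous f)
    (hM : ∀ ω ∈ Set.Icc (-π) π, |f ω| ≤ M) (x y : Fin n → ℝ) :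
    x ⬝ᵥ (toeplitz f n *ᵥ y) ≤ M / 2 * (x ⬝ᵥ x + y ⬝ᵥ y) := by
  rw [dotProduct_toeplitz_mulVec hf, dotProduct_self_eq_integral, dotProduct_self_eq_integral,
    ← mul_add, mul_left_comm, ← intervalIntegral.integral_add
      (Continuous.intervalIntegrable (by fun_prop) _ _)
      (Continuous.intervalIntegrable (by fun_prop) _ _),
    ← intervalIntegral.integral_const_mul (M / 2)]
  refine mul_le_mul_of_nonneg_left ?_ (show (0 : ℝ) ≤ (2 * π)⁻¹ by positivity)
  refine intervalIntegral.integral_mono_on neg_pi_lt_pi.le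
    (Continuous.intervalIntegrable (by fun_prop) _ _)
    (Continuous.intervalIntegrable (by fun_prop) _ _) fun ω hω => ?_
  set a := ∑ s, x s * Real.cos (s.val * ω)
  set b := ∑ s, y s * Real.cos (s.val * ω)
  set c := ∑ s, x s * Real.sin (s.val * ω)
  set d := ∑ s, y s * Real.sin (s.val * ω)
  have h1 : |a * b + c * d| ≤ (a ^ 2 + c ^ 2 + (b ^ 2 + d ^ 2)) / 2 :=
    abs_le.2 ⟨by nlinarith [sq_nonneg (a + b), sq_nonneg (c + d)],
      by nlinarith [sq_nonneg (a - b), sq_nonneg (c - d)]⟩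
  calc f ω * (a * b + c * d) ≤ |f ω| * |a * b + c * d| := (le_abs_self _).trans (abs_mul _ _).le
    _ ≤ M * ((a ^ 2 + c ^ 2 + (b ^ 2 + d ^ 2)) / 2) :=
        mul_le_mul (hM ω hω) h1 (abs_nonneg _) ((abs_nonneg _).trans (hM ω hω))
    _ = _ := by ring

theorem dotProduct_self_eq_norm_sq (x : Fin n → ℝ) : x ⬝ᵥ x = ‖WithLp.toLp 2 x‖ ^ 2 := by
  rw [EuclideanSpace.real_norm_sq_eq]
  simp [dotProduct, sq]

theorem norm_toLp_mulVec_le (A : Matrix (Fin n) (Fin n) ℝ) (x : Fin n → ℝ) :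
    ‖WithLp.toLp 2 (A *ᵥ x)‖ ≤ ‖A‖ * ‖WithLp.toLp 2 x‖ :=
  l2_opNorm_mulVec A (WithLp.toLp 2 x)

theorem l2_opNorm_le {A : Matrix (Fin n) (Fin n) ℝ} {M : ℝ} (hM : 0 ≤ M)
    (h : ∀ x : Fin n → ℝ, ‖WithLp.toLp 2 (A *ᵥ x)‖ ≤ M * ‖WithLp.toLp 2 x‖) : ‖A‖ ≤ M := by
  rw [l2_opNorm_def]
  exact ContinuousLinearMap.opNorm_le_bound _ hM fun x => h x.ofLp

theorem abs_dotProduct_mulVec_le (B : Matrix (Fin n) (Fin n) ℝ) (v u : Fin n → ℝ) :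
    |v ⬝ᵥ (B *ᵥ u)| ≤ ‖B‖ * ((v ⬝ᵥ v + u ⬝ᵥ u) / 2) := by
  have h1 : |v ⬝ᵥ (B *ᵥ u)| ≤ ‖WithLp.toLp 2 v‖ * ‖WithLp.toLp 2 (B *ᵥ u)‖ := by
    have := abs_real_inner_le_norm (WithLp.toLp 2 v) (WithLp.toLp 2 (B *ᵥ u))
    rw [EuclideanSpace.inner_toLp_toLp] at this
    simpa [dotProduct_comm] using this
  rw [dotProduct_self_eq_norm_sq, dotProduct_self_eq_norm_sq]
  have h2 := norm_toLp_mulVec_le B u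
  have hv := norm_nonneg (WithLp.toLp 2 v)
  have hB := norm_nonneg B
  nlinarith [mul_le_mul_of_nonneg_left h2 hv,
    mul_nonneg hB (sq_nonneg (‖WithLp.toLp 2 v‖ - ‖WithLp.toLp 2 u‖))]

theorem norm_toeplitz_le {M : ℝ} (hf : Continuous f)
    (hM : ∀ ω ∈ Set.Icc (-π) π, |f ω| ≤ M) (n : ℕ) : ‖toeplitz f n‖ ≤ M := by
  have hM0 : 0 ≤ M := (abs_nonneg _).trans (hM 0 ⟨by linarith [Real.pi_pos], Real.pi_pos.le⟩)
  refine l2_opNorm_le hM0 fun y => ?_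
  set z := toeplitz f n *ᵥ y with hz
  set a := ‖WithLp.toLp 2 z‖
  set b := ‖WithLp.toLp 2 y‖
  have ha : 0 ≤ a := norm_nonneg _
  have hb : 0 ≤ b := norm_nonneg _
  -- the bilinear bound for vectors scaled to the same length
  have h := dotProduct_toeplitz_mulVec_le hf hM (b • z) (a • y)
  rw [mulVec_smul, ← hz] at h
  simp only [smul_dotProduct, dotProduct_smul, smul_eq_mul, dotProduct_self_eq_norm_sq] at h
  change a * (b * a ^ 2) ≤ M / 2 * (b * (b * a ^ 2) + a * (a * b ^ 2)) at h
  rcases ha.eq_or_lt with ha0 | ha0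
  · rw [← ha0]; positivity
  rcases hb.eq_or_lt with hb0 | hb0
  · exfalso
    have hy : WithLp.toLp 2 y = 0 := norm_eq_zero.1 hb0.symm
    have hy' : y = 0 := by simpa using hy
    have : a = 0 := by simp [a, hz, hy']
    exact ha0.ne' this
  have h3 : (a ^ 2 * b) * a ≤ (a ^ 2 * b) * (M * b) := by linarith
  exact le_of_mul_le_mul_left h3 (by positivity)

theorem posDef_toeplitz {m : ℝ} (hf : Continuous f) (hm0 : 0 < m)
    (hm : ∀ ω ∈ Set.Icc (-π) π, m ≤ f ω) (n : ℕ) : (toeplitz f n).PosDef := by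
  refine PosDef.of_dotProduct_mulVec_pos ?_ fun {x} hx => ?_
  · ext s t
    simp [toeplitz, conjTranspose_apply, ← cosCoeff_neg f ((s.val : ℤ) - t.val)]
  · have h := le_dotProduct_toeplitz_mulVec hf hm x
    have hx' : 0 < x ⬝ᵥ x := by
      simpa using (dotProduct_star_self_pos_iff (v := x)).2 hx
    simpa using (mul_pos hm0 hx').trans_le h

theorem norm_inv_toeplitz_le {m : ℝ} (hf : Continuous f) (hm0 : 0 < m)
    (hm : ∀ ω ∈ Set.Icc (-π) π, m ≤ f ω) (n : ℕ) : ‖(toeplitz f n)⁻¹‖ ≤ m⁻¹ := by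
  refine l2_opNorm_le (by positivity) fun z => ?_
  have hu : IsUnit (toeplitz f n).det := (posDef_toeplitz hf hm0 hm n).det_pos.ne'.isUnit
  set y := (toeplitz f n)⁻¹ *ᵥ z with hy
  have hz : z = toeplitz f n *ᵥ y := by
    rw [hy, mulVec_mulVec, mul_nonsing_inv _ hu, one_mulVec]
  have h := le_dotProduct_toeplitz_mulVec hf hm y
  rw [← hz, dotProduct_self_eq_norm_sq] at h
  have h1 : y ⬝ᵥ z ≤ ‖WithLp.toLp 2 y‖ * ‖WithLp.toLp 2 z‖ := by
    have := real_inner_le_norm (WithLp.toLp 2 y) (WithLp.toLp 2 z)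
    rw [EuclideanSpace.inner_toLp_toLp] at this
    simpa [dotProduct_comm] using this
  rw [inv_mul_eq_div, le_div_iff₀ hm0]
  rcases (norm_nonneg (WithLp.toLp 2 y)).eq_or_lt with h0 | h0
  · rw [← h0]; simp
  · refine le_of_mul_le_mul_left ?_ h0
    calc _ = m * ‖WithLp.toLp 2 y‖ ^ 2 := by ring
      _ ≤ _ := h.trans h1

end Toeplitz

/-! ### Sequences of matrices that are Toeplitz up to bounded trace norm -/

section TraceNorm

open scoped Matrix.Norms.L2Operator

theorem intCast_val_injective (n : ℕ) : Function.Injective fun s : Fin n => (s.val : ℤ) :=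
  fun s t h => Fin.ext (by simpa using h)

/-- The index set `{0, …, n - 1}` inside `ℤ`. -/
def block (n : ℕ) : Finset ℤ := Finset.univ.image fun s : Fin n => (s.val : ℤ)

theorem mem_block {n : ℕ} {r : ℤ} : r ∈ block n ↔ 0 ≤ r ∧ r < n := by
  simp only [block, Finset.mem_image, Finset.mem_univ, true_and]
  constructor
  · rintro ⟨s, rfl⟩
    omega
  · rintro ⟨h0, h1⟩
    exact ⟨⟨r.toNat, by omega⟩, by simp [h0]⟩

/-- A shift by `m` moves at most `|m|` elements out of a block. -/
theorem card_shift_not_mem_block_le (n : ℕ) (m : ℤ) :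
    (Finset.univ.filter fun s : Fin n => (s.val : ℤ) - m ∉ block n).card ≤ m.natAbs := by
  rw [← Finset.card_image_of_injective _ (intCast_val_injective n)]
  refine (Finset.card_le_card (t := if 0 ≤ m then Finset.Ico 0 m else Finset.Ico (n + m) n)
    ?_).trans ?_
  · intro r hr
    simp only [Finset.mem_image, Finset.mem_filter, Finset.mem_univ, true_and, mem_block] at hr
    obtain ⟨s, hs, rfl⟩ := hr
    have := s.2
    split_ifs with h <;> simp only [Finset.mem_Ico] <;> omega
  · split_ifs with h <;> simp only [Int.card_Ico] <;> omega

/-- The squared norm of the part of the row of index `r` of the infinite Toeplitz matrix of `f` with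
columns in the block, for `r` outside the block. -/
def outerRow (f : ℝ → ℝ) (n : ℕ) (r : ℤ) : ℝ :=
  ∑ s : Fin n, if r ∈ block n then 0 else cosCoeff f (s.val - r) ^ 2

theorem summable_cosCoeff_sq {f : ℝ → ℝ} (hf : IsSymbol f) :
    Summable fun m : ℤ => cosCoeff f m ^ 2 := by
  have h := (hasSum_cosCoeff_mul hf.continuous hf.continuous hf.even hf.even 0 0).summable
  refine h.congr fun m => ?_
  rw [zero_sub, sub_zero, cosCoeff_neg, sq]

/-- The Hilbert–Schmidt norms of the corners cut off by the blocks are bounded: this is where the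
smoothness of the symbol enters. -/
theorem hasSum_outerRow_le {f : ℝ → ℝ} (hf : IsSymbol f) :
    ∃ D, ∀ n, ∃ d ≤ D, HasSum (outerRow f n) d := by
  have hc := summable_cosCoeff_sq hf
  have hm := summable_sq_mul_cosCoeff_sq hf.contDiff
  refine ⟨∑' m : ℤ, (m : ℝ) ^ 2 * cosCoeff f m ^ 2, fun n => ?_⟩
  have h1 : ∀ s : Fin n, Summable fun m : ℤ =>
      if (s.val : ℤ) - m ∈ block n then 0 else cosCoeff f m ^ 2 := fun s => by
    refine Summable.of_nonneg_of_le (fun m => ?_) (fun m => ?_) hc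
    · split_ifs <;> positivity
    · split_ifs
      · positivity
      · rfl
  have h2 : ∀ s : Fin n, HasSum
      (fun r : ℤ => if r ∈ block n then 0 else cosCoeff f (s.val - r) ^ 2)
      (∑' m : ℤ, if (s.val : ℤ) - m ∈ block n then 0 else cosCoeff f m ^ 2) := fun s => by
    rw [← (Equiv.subLeft (s.val : ℤ)).hasSum_iff]
    refine (h1 s).hasSum.congr_fun fun m => ?_
    simp
  refine ⟨_, ?_, hasSum_sum fun s _ => h2 s⟩
  rw [← Summable.tsum_finsetSum fun s _ => h1 s]
  refine Summable.tsum_le_tsum (fun m => ?_) (summable_sum fun s _ => h1 s) hm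
  have h3 : ∑ s : Fin n, (if (s.val : ℤ) - m ∈ block n then 0 else cosCoeff f m ^ 2) =
      (Finset.univ.filter fun s : Fin n => (s.val : ℤ) - m ∉ block n).card *
        cosCoeff f m ^ 2 := by
    rw [← nsmul_eq_mul, ← Finset.sum_const, Finset.sum_filter]
    exact Finset.sum_congr rfl fun s _ => by split_ifs <;> simp_all
  rw [h3]
  refine mul_le_mul_of_nonneg_right ?_ (sq_nonneg _)
  have h4 : ((Finset.univ.filter fun s : Fin n => (s.val : ℤ) - m ∉ block n).card : ℤ) ≤ m ^ 2 := by
    have := card_shift_not_mem_block_le n m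
    have h5 := Int.natAbs_le_self_sq m
    omega
  exact_mod_cast h4

/-- The trace norms of the matrices `E n` are bounded. By duality, the trace norm of `E` is the
supremum of `|tr (E B)|` over all `B` of operator norm at most one. -/
def TraceNormBounded (E : ∀ n : ℕ, Matrix (Fin n) (Fin n) ℝ) : Prop :=
  ∃ C, ∀ (n : ℕ) (B : Matrix (Fin n) (Fin n) ℝ), |(E n * B).trace| ≤ C * ‖B‖

theorem norm_one_le (n : ℕ) : ‖(1 : Matrix (Fin n) (Fin n) ℝ)‖ ≤ 1 :=
  l2_opNorm_le zero_le_one fun x => by simp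

theorem TraceNormBounded.trace {E : ∀ n : ℕ, Matrix (Fin n) (Fin n) ℝ} (hE : TraceNormBounded E) :
    ∃ C, ∀ n, |(E n).trace| ≤ C := by
  obtain ⟨C, hC⟩ := hE
  refine ⟨max C 0, fun n => ?_⟩
  have h := hC n 1
  rw [mul_one] at h
  calc _ ≤ C * ‖(1 : Matrix (Fin n) (Fin n) ℝ)‖ := h
    _ ≤ max C 0 * 1 := mul_le_mul (le_max_left _ _) (norm_one_le n) (norm_nonneg _)
      (le_max_right _ _)
    _ = _ := mul_one _

variable {E E' M : ∀ n : ℕ, Matrix (Fin n) (Fin n) ℝ}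

theorem TraceNormBounded.add (hE : TraceNormBounded E) (hE' : TraceNormBounded E') :
    TraceNormBounded fun n => E n + E' n := by
  obtain ⟨C, hC⟩ := hE
  obtain ⟨C', hC'⟩ := hE'
  refine ⟨C + C', fun n B => ?_⟩
  rw [add_mul, trace_add, add_mul]
  exact (abs_add_le _ _).trans (add_le_add (hC n B) (hC' n B))

theorem TraceNormBounded.neg (hE : TraceNormBounded E) : TraceNormBounded fun n => -E n := by
  obtain ⟨C, hC⟩ := hE
  refine ⟨C, fun n B => ?_⟩
  rw [neg_mul, trace_neg, abs_neg]
  exact hC n B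

theorem TraceNormBounded.mul_right (hE : TraceNormBounded E) (hM : ∃ C, ∀ n, ‖M n‖ ≤ C) :
    TraceNormBounded fun n => E n * M n := by
  obtain ⟨C, hC⟩ := hE
  obtain ⟨K, hK⟩ := hM
  refine ⟨max C 0 * K, fun n B => ?_⟩
  rw [Matrix.mul_assoc]
  calc _ ≤ C * ‖M n * B‖ := hC n _
    _ ≤ max C 0 * (K * ‖B‖) := mul_le_mul (le_max_left _ _)
      ((l2_opNorm_mul _ _).trans (mul_le_mul_of_nonneg_right (hK n) (norm_nonneg _)))
      (norm_nonneg _) (le_max_right _ _)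
    _ = _ := by ring

theorem TraceNormBounded.mul_left (hE : TraceNormBounded E) (hM : ∃ C, ∀ n, ‖M n‖ ≤ C) :
    TraceNormBounded fun n => M n * E n := by
  obtain ⟨C, hC⟩ := hE
  obtain ⟨K, hK⟩ := hM
  refine ⟨max C 0 * K, fun n B => ?_⟩
  rw [Matrix.mul_assoc, trace_mul_comm, Matrix.mul_assoc]
  calc _ ≤ C * ‖B * M n‖ := hC n _
    _ ≤ max C 0 * (‖B‖ * K) := mul_le_mul (le_max_left _ _)
      ((l2_opNorm_mul _ _).trans (mul_le_mul_of_nonneg_left (hK n) (norm_nonneg _)))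
      (norm_nonneg _) (le_max_right _ _)
    _ = _ := by ring

variable {f g : ℝ → ℝ}

theorem hasSum_toeplitz_mul_sub (hf : IsSymbol f) (hg : IsSymbol g) {n : ℕ} (s t : Fin n) :
    HasSum (fun r : ℤ => if r ∈ block n then 0 else
        cosCoeff f (s.val - r) * cosCoeff g (r - t.val))
      ((toeplitz (fun ω => f ω * g ω) n - toeplitz f n * toeplitz g n) s t) := by
  have h := hasSum_cosCoeff_mul hf.continuous hg.continuous hf.even hg.even s.val t.val
  have h' : HasSum (fun r : ℤ => if r ∈ block n then
      cosCoeff f (s.val - r) * cosCoeff g (r - t.val) else 0)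
      ((toeplitz f n * toeplitz g n) s t) := by
    convert hasSum_sum_of_ne_finset_zero (L := .unconditional ℤ) (s := block n)
      (f := fun r : ℤ => if r ∈ block n then
        cosCoeff f (s.val - r) * cosCoeff g (r - t.val) else 0) fun r hr => if_neg hr using 1
    rw [Finset.sum_congr rfl fun r hr => if_pos hr]
    rw [block, Finset.sum_image fun _ _ _ _ h => intCast_val_injective n h]
    simp [toeplitz, mul_apply]
  refine (h.sub h').congr_fun fun r => ?_
  split_ifs <;> simp

/-- The product of two Toeplitz matrices differs from the Toeplitz matrix of the product by a matrix
of bounded trace norm. The difference is a sum of products of Hankel matrices, that is, of rank one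
matrices indexed by the integers outside the block. -/
theorem traceNormBounded_toeplitz_mul (hf : IsSymbol f) (hg : IsSymbol g) :
    TraceNormBounded fun n => toeplitz (fun ω => f ω * g ω) n - toeplitz f n * toeplitz g n := by
  obtain ⟨D, hD⟩ := hasSum_outerRow_le hf
  obtain ⟨D', hD'⟩ := hasSum_outerRow_le hg
  refine ⟨(D' + D) / 2, fun n B => ?_⟩
  obtain ⟨d, hd, hsd⟩ := hD n
  obtain ⟨d', hd', hsd'⟩ := hD' n
  have hsum := hasSum_sum (s := Finset.univ) fun (s : Fin n) _ => hasSum_sum (s := Finset.univ)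
    fun (t : Fin n) _ => (hasSum_toeplitz_mul_sub hf hg s t).mul_right (B t s)
  have htr : ((toeplitz (fun ω => f ω * g ω) n - toeplitz f n * toeplitz g n) * B).trace =
      ∑ s, ∑ t, (toeplitz (fun ω => f ω * g ω) n - toeplitz f n * toeplitz g n) s t * B t s := by
    simp only [trace, diag, mul_apply]
  rw [htr, ← hsum.tsum_eq, ← Real.norm_eq_abs]
  have hb := (((hsd'.add hsd).div_const 2).mul_left ‖B‖)
  refine (tsum_of_norm_bounded hb fun r => ?_).trans ?_
  · by_cases hr : r ∈ block n
    · simp [hr, outerRow]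
    · have h := abs_dotProduct_mulVec_le B (fun t => cosCoeff g (t.val - r))
        (fun s => cosCoeff f (s.val - r))
      rw [Real.norm_eq_abs]
      convert! h using 2
      · simp only [hr, if_false, dotProduct, mulVec, Finset.mul_sum]
        rw [Finset.sum_comm]
        refine Finset.sum_congr rfl fun t _ => Finset.sum_congr rfl fun s _ => ?_
        rw [← cosCoeff_neg g (r - t.val), neg_sub]
        ring
      · simp [outerRow, hr, dotProduct, sq]
  · rw [mul_comm]
    exact mul_le_mul_of_nonneg_right (by linarith) (norm_nonneg _)

/-- The matrices `M n` have bounded operator norms, and they differ from the Toeplitz matrices of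
the symbol `f` by matrices of bounded trace norm. -/
structure IsAsympToeplitz (M : ∀ n : ℕ, Matrix (Fin n) (Fin n) ℝ) (f : ℝ → ℝ) : Prop where
  isSymbol : IsSymbol f
  bounded : ∃ C, ∀ n, ‖M n‖ ≤ C
  error : TraceNormBounded fun n => M n - toeplitz f n

theorem IsSymbol.exists_norm_toeplitz_le (hf : IsSymbol f) : ∃ C, ∀ n, ‖toeplitz f n‖ ≤ C := by
  obtain ⟨C, hC⟩ := isCompact_Icc.exists_bound_of_continuousOn (s := Set.Icc (-π) π)
    hf.continuous.continuousOn
  exact ⟨C, norm_toeplitz_le hf.continuous hC⟩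

theorem isAsympToeplitz_toeplitz (hf : IsSymbol f) : IsAsympToeplitz (toeplitz f) f :=
  ⟨hf, hf.exists_norm_toeplitz_le, 0, by simp⟩

theorem IsAsympToeplitz.mul {N : ∀ n : ℕ, Matrix (Fin n) (Fin n) ℝ} (hM : IsAsympToeplitz M f)
    (hN : IsAsympToeplitz N g) : IsAsympToeplitz (fun n => M n * N n) fun ω => f ω * g ω := by
  refine ⟨hM.isSymbol.mul hN.isSymbol, ?_, ?_⟩
  · obtain ⟨C, hC⟩ := hM.bounded
    obtain ⟨C', hC'⟩ := hN.bounded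
    exact ⟨C * C', fun n => (l2_opNorm_mul _ _).trans
      (mul_le_mul (hC n) (hC' n) (norm_nonneg _) ((norm_nonneg _).trans (hC n)))⟩
  · convert ((hM.error.mul_right hN.bounded).add
      (hN.error.mul_left hM.isSymbol.exists_norm_toeplitz_le)).add
      (traceNormBounded_toeplitz_mul hM.isSymbol hN.isSymbol).neg using 2 with n
    noncomm_ring

/-- The inverses of the Toeplitz matrices of a positive symbol. -/
theorem isAsympToeplitz_inv (hf : IsSymbol f) (hpos : ∀ ω, 0 < f ω) :
    IsAsympToeplitz (fun n => (toeplitz f n)⁻¹) fun ω => (f ω)⁻¹ := by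
  obtain ⟨x, -, hx⟩ := isCompact_Icc.exists_isMinOn (s := Set.Icc (-π) π)
    ⟨0, by constructor <;> linarith [Real.pi_pos]⟩ hf.continuous.continuousOn
  have hi := hf.inv fun ω => (hpos ω).ne'
  have hb : ∃ C, ∀ n, ‖(toeplitz f n)⁻¹‖ ≤ C :=
    ⟨_, norm_inv_toeplitz_le hf.continuous (hpos x) fun ω hω => hx hω⟩
  refine ⟨hi, hb, ?_⟩
  convert (traceNormBounded_toeplitz_mul hf hi).mul_left hb using 2 with n
  have hu : IsUnit (toeplitz f n).det :=
    (posDef_toeplitz hf.continuous (hpos x) (fun ω hω => hx hω) n).det_pos.ne'.isUnit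
  have h1 : toeplitz (fun ω => f ω * (f ω)⁻¹) n = 1 := by
    simp only [fun ω => mul_inv_cancel₀ (hpos ω).ne', toeplitz_one]
  rw [h1, Matrix.mul_sub, mul_one, ← Matrix.mul_assoc, nonsing_inv_mul _ hu, one_mul]

theorem IsAsympToeplitz.trace (hM : IsAsympToeplitz M f) :
    ∃ C, ∀ n : ℕ, |(M n).trace - n * cosCoeff f 0| ≤ C := by
  obtain ⟨C, hC⟩ := hM.error.trace
  refine ⟨C, fun n => ?_⟩
  rw [← trace_toeplitz, ← trace_sub]
  exact hC n

end TraceNorm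

/-! ### Derivatives of matrix-valued functions -/

section MatrixCalculus

variable {k : ℕ} {Θ : Set (Fin k → ℝ)} {θ : Fin k → ℝ} {ι : Type*}

/-- The entrywise partial derivative `∂_i M(θ)` of a matrix-valued function. -/
def matPd (i : Fin k) (M : (Fin k → ℝ) → Matrix ι ι ℝ) (θ : Fin k → ℝ) : Matrix ι ι ℝ :=
  Matrix.of fun s t => pd i (fun t' => M t' s t) θ

/-- The entries of `M` are `m` times continuously differentiable on `Θ`. -/
def MatContDiffOn (Θ : Set (Fin k → ℝ)) (m : ℕ) (M : (Fin k → ℝ) → Matrix ι ι ℝ) : Prop :=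
  ∀ s t, ContDiffOn ℝ m (fun θ => M θ s t) Θ

variable {m : ℕ} {M N : (Fin k → ℝ) → Matrix ι ι ℝ}

theorem MatContDiffOn.of_le {m' : ℕ} (hM : MatContDiffOn Θ m M) (h : m' ≤ m) :
    MatContDiffOn Θ m' M :=
  fun s t => (hM s t).of_le (by exact_mod_cast h)

theorem MatContDiffOn.neg (hM : MatContDiffOn Θ m M) : MatContDiffOn Θ m fun θ => -M θ :=
  fun s t => (hM s t).neg

theorem MatContDiffOn.add (hM : MatContDiffOn Θ m M) (hN : MatContDiffOn Θ m N) :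
    MatContDiffOn Θ m fun θ => M θ + N θ :=
  fun s t => (hM s t).add (hN s t)

theorem MatContDiffOn.matPd (hΘ : IsOpen Θ) (hM : MatContDiffOn Θ (m + 1) M) (i : Fin k) :
    MatContDiffOn Θ m (matPd i M) :=
  fun s t => contDiffOn_pd hΘ (hM s t) i

theorem hasLineDerivAt_pd (hΘ : IsOpen Θ) {f : (Fin k → ℝ) → ℝ} (hf : ContDiffOn ℝ 1 f Θ)
    (hθ : θ ∈ Θ) (i : Fin k) : HasLineDerivAt ℝ f (pd i f θ) θ (Pi.single i 1) :=
  ((hf.differentiableOn (by simp)).differentiableAt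
    (hΘ.mem_nhds hθ)).lineDifferentiableAt.hasLineDerivAt

theorem MatContDiffOn.hasLineDerivAt (hΘ : IsOpen Θ) (hM : MatContDiffOn Θ 1 M) (hθ : θ ∈ Θ)
    (i : Fin k) (s t : ι) :
    HasLineDerivAt ℝ (fun θ => M θ s t) (ARMA.matPd i M θ s t) θ (Pi.single i 1) :=
  hasLineDerivAt_pd hΘ (by exact_mod_cast hM s t) hθ i

theorem matPd_congr (hΘ : IsOpen Θ) (h : Set.EqOn M N Θ) (hθ : θ ∈ Θ) (i : Fin k) :
    matPd i M θ = matPd i N θ := by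
  ext s t
  exact pd_congr hΘ (f := fun θ => M θ s t) (g := fun θ => N θ s t)
    (fun θ hθ => congrFun₂ (h hθ) s t) hθ i

theorem matPd_neg (i : Fin k) (M : (Fin k → ℝ) → Matrix ι ι ℝ) (θ : Fin k → ℝ) :
    matPd i (fun θ => -M θ) θ = -matPd i M θ := by
  ext s t
  simp [matPd, pd, lineDeriv, deriv.fun_neg]

theorem matPd_add (hΘ : IsOpen Θ) (hM : MatContDiffOn Θ 1 M) (hN : MatContDiffOn Θ 1 N)
    (hθ : θ ∈ Θ) (i : Fin k) :
    matPd i (fun θ => M θ + N θ) θ = matPd i M θ + matPd i N θ := by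
  ext s t
  exact (HasDerivAt.add (hM.hasLineDerivAt hΘ hθ i s t) (hN.hasLineDerivAt hΘ hθ i s t)).deriv

variable [Fintype ι]

theorem MatContDiffOn.mul (hM : MatContDiffOn Θ m M) (hN : MatContDiffOn Θ m N) :
    MatContDiffOn Θ m fun θ => M θ * N θ := fun s t => by
  simp only [mul_apply]
  exact ContDiffOn.sum fun j _ => (hM s j).mul (hN j t)

theorem matPd_mul (hΘ : IsOpen Θ) (hM : MatContDiffOn Θ 1 M) (hN : MatContDiffOn Θ 1 N)
    (hθ : θ ∈ Θ) (i : Fin k) :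
    matPd i (fun θ => M θ * N θ) θ = matPd i M θ * N θ + M θ * matPd i N θ := by
  ext s t
  have h := HasDerivAt.fun_sum (u := Finset.univ) fun j _ =>
    HasDerivAt.fun_mul (hM.hasLineDerivAt hΘ hθ i s j) (hN.hasLineDerivAt hΘ hθ i j t)
  simp only [zero_smul, add_zero] at h
  rw [Matrix.add_apply, mul_apply, mul_apply, ← Finset.sum_add_distrib]
  exact h.deriv

theorem pd_trace (hΘ : IsOpen Θ) (hM : MatContDiffOn Θ 1 M) (hθ : θ ∈ Θ) (i : Fin k) :
    pd i (fun θ => (M θ).trace) θ = (matPd i M θ).trace :=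
  (HasDerivAt.fun_sum (u := Finset.univ) fun j _ => hM.hasLineDerivAt hΘ hθ i j j).deriv

theorem pd_quadraticForm (hΘ : IsOpen Θ) (hM : MatContDiffOn Θ 1 M) (hθ : θ ∈ Θ) (i : Fin k)
    (x : ι → ℝ) : pd i (fun θ => x ⬝ᵥ (M θ *ᵥ x)) θ = x ⬝ᵥ (matPd i M θ *ᵥ x) := by
  simp only [dotProduct_mulVec_eq_sum]
  exact (HasDerivAt.fun_sum (u := Finset.univ) fun (p : ι × ι) _ =>
    (hM.hasLineDerivAt hΘ hθ i p.1 p.2).mul_const _).deriv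

theorem contDiffOn_quadraticForm (hM : MatContDiffOn Θ m M) (x : ι → ℝ) :
    ContDiffOn ℝ m (fun θ => x ⬝ᵥ (M θ *ᵥ x)) Θ := by
  simp only [dotProduct_mulVec_eq_sum]
  exact ContDiffOn.sum fun p _ => (hM _ _).mul contDiffOn_const

theorem MatContDiffOn.trace (hM : MatContDiffOn Θ m M) :
    ContDiffOn ℝ m (fun θ => (M θ).trace) Θ :=
  ContDiffOn.sum fun j _ => hM j j

variable [DecidableEq ι]

theorem MatContDiffOn.det (hM : MatContDiffOn Θ m M) : ContDiffOn ℝ m (fun θ => (M θ).det) Θ := by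
  simp only [det_apply']
  exact ContDiffOn.sum fun σ _ => contDiffOn_const.mul (contDiffOn_prod fun i _ => hM _ _)

theorem MatContDiffOn.inv (hM : MatContDiffOn Θ m M) (h : ∀ θ ∈ Θ, (M θ).det ≠ 0) :
    MatContDiffOn Θ m fun θ => (M θ)⁻¹ := fun s t => by
  simp only [inv_def, Matrix.smul_apply, smul_eq_mul, Ring.inverse_eq_inv', adjugate_apply]
  refine (hM.det.inv h).mul (MatContDiffOn.det (M := fun θ => (M θ).updateRow t (Pi.single s 1))
    fun a b => ?_)
  by_cases hat : a = t
  · subst hat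
    simpa only [updateRow_self] using contDiffOn_const
  · simpa only [updateRow_ne hat] using hM a b

theorem matPd_inv (hΘ : IsOpen Θ) (hM : MatContDiffOn Θ 1 M) (h : ∀ θ ∈ Θ, (M θ).det ≠ 0)
    (hθ : θ ∈ Θ) (i : Fin k) :
    matPd i (fun θ => (M θ)⁻¹) θ = -((M θ)⁻¹ * matPd i M θ * (M θ)⁻¹) := by
  have h1 := matPd_mul hΘ (hM.inv h) hM hθ i
  have h2 : matPd i (fun θ => (M θ)⁻¹ * M θ) θ = 0 := by
    rw [matPd_congr hΘ (N := fun _ => 1) (fun θ hθ => nonsing_inv_mul _ (h θ hθ).isUnit) hθ i]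
    ext s t
    simp [matPd, pd, lineDeriv]
  rw [h2] at h1
  have h3 := congrArg (· * (M θ)⁻¹) h1
  simp only [Matrix.zero_mul, Matrix.add_mul, Matrix.mul_assoc,
    mul_nonsing_inv _ (h θ hθ).isUnit, Matrix.mul_one] at h3
  rw [Matrix.mul_assoc]
  exact eq_neg_of_add_eq_zero_left h3.symm

/-- **Jacobi's formula** for the derivative of a determinant. -/
theorem hasDerivAt_det {c : ℝ → Matrix ι ι ℝ} {c' : Matrix ι ι ℝ} {t : ℝ}
    (hc : ∀ i j, HasDerivAt (fun t => c t i j) (c' i j) t) :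
    HasDerivAt (fun t => (c t).det) ((c t).adjugate * c').trace t := by
  have h := HasDerivAt.fun_sum (u := Finset.univ) fun (σ : Equiv.Perm ι) _ =>
    (HasDerivAt.fun_finsetProd (u := Finset.univ) fun j _ => hc (σ j) j).const_mul
      ((Equiv.Perm.sign σ : ℤ) : ℝ)
  simp only [det_apply']
  refine h.congr_deriv ?_
  have e : ∀ j, ((c t).adjugate * c') j j = ((c t).updateCol j fun i => c' i j).det := fun j => by
    rw [← cramer_apply, cramer_eq_adjugate_mulVec]
    rfl
  simp only [trace, diag, e, det_apply', Finset.mul_sum]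
  rw [Finset.sum_comm]
  refine Finset.sum_congr rfl fun j _ => Finset.sum_congr rfl fun σ _ => ?_
  congr 1
  rw [← Finset.prod_erase_mul _ _ (Finset.mem_univ j), updateCol_self, smul_eq_mul]
  congr 1
  exact Finset.prod_congr rfl fun a ha => by rw [updateCol_ne (Finset.ne_of_mem_erase ha)]

theorem pd_log_det (hΘ : IsOpen Θ) (hM : MatContDiffOn Θ 1 M) (h : ∀ θ ∈ Θ, (M θ).det ≠ 0)
    (hθ : θ ∈ Θ) (i : Fin k) :
    pd i (fun θ => Real.log (M θ).det) θ = ((M θ)⁻¹ * matPd i M θ).trace := by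
  have h1 := (hasDerivAt_det fun s t => hM.hasLineDerivAt hΘ hθ i s t).log
    (by simpa using h θ hθ)
  refine h1.deriv.trans ?_
  simp only [zero_smul, add_zero]
  rw [inv_def, Ring.inverse_eq_inv', Matrix.smul_mul, trace_smul, smul_eq_mul, inv_mul_eq_div]

end MatrixCalculus

/-! ### Derivatives of Gaussian log likelihoods and their expectations -/

section GaussianLikelihood

variable {k : ℕ} {Θ : Set (Fin k → ℝ)} {θ : Fin k → ℝ} {ι : Type*} [Fintype ι]

theorem pd_quadraticForm_sub_trace (hΘ : IsOpen Θ) {M N : (Fin k → ℝ) → Matrix ι ι ℝ}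
    (hM : MatContDiffOn Θ 1 M) (hN : MatContDiffOn Θ 1 N) (hθ : θ ∈ Θ) (i : Fin k) (x : ι → ℝ) :
    pd i (fun θ => -(1 / 2) * (x ⬝ᵥ (M θ *ᵥ x)) - 1 / 2 * (N θ).trace) θ =
      -(1 / 2) * (x ⬝ᵥ (matPd i M θ *ᵥ x)) - 1 / 2 * (matPd i N θ).trace := by
  have h1 := hasLineDerivAt_pd hΘ (by exact_mod_cast contDiffOn_quadraticForm hM x) hθ i
  have h2 := hasLineDerivAt_pd hΘ (by exact_mod_cast hN.trace) hθ i
  rw [pd_quadraticForm hΘ hM hθ] at h1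
  rw [pd_trace hΘ hN hθ] at h2
  exact ((HasDerivAt.const_mul (-(1 / 2)) h1).sub (HasDerivAt.const_mul (1 / 2) h2)).deriv

variable [DecidableEq ι]

/-- The log likelihood, up to a constant, of the centred Gaussian law with covariance matrix
`C(θ)`. -/
def gaussianLogLik (C : (Fin k → ℝ) → Matrix ι ι ℝ) (x : ι → ℝ) (θ : Fin k → ℝ) : ℝ :=
  -(1 / 2) * (x ⬝ᵥ ((C θ)⁻¹ *ᵥ x)) - 1 / 2 * Real.log (C θ).det

/-- A family of positive definite matrices, three times continuously differentiable on the open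
set `Θ`. -/
structure IsCovFamily (Θ : Set (Fin k → ℝ)) (C : (Fin k → ℝ) → Matrix ι ι ℝ) : Prop where
  isOpen : IsOpen Θ
  smooth : MatContDiffOn Θ 3 C
  posDef : ∀ θ ∈ Θ, (C θ).PosDef

namespace IsCovFamily

variable {C : (Fin k → ℝ) → Matrix ι ι ℝ}

theorem det_ne_zero (hC : IsCovFamily Θ C) (θ : Fin k → ℝ) (hθ : θ ∈ Θ) : (C θ).det ≠ 0 :=
  (hC.posDef θ hθ).det_pos.ne'

theorem smooth_inv (hC : IsCovFamily Θ C) : MatContDiffOn Θ 3 fun θ => (C θ)⁻¹ :=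
  hC.smooth.inv hC.det_ne_zero

theorem smooth_inv_mul (hC : IsCovFamily Θ C) (l : Fin k) :
    MatContDiffOn Θ 2 fun θ => (C θ)⁻¹ * matPd l C θ :=
  (hC.smooth_inv.of_le (by norm_num)).mul (hC.smooth.matPd hC.isOpen l)

theorem contDiffOn_gaussianLogLik (hC : IsCovFamily Θ C) (x : ι → ℝ) :
    ContDiffOn ℝ 3 (gaussianLogLik C x) Θ :=
  (contDiffOn_const.mul (contDiffOn_quadraticForm hC.smooth_inv x)).sub
    (contDiffOn_const.mul (hC.smooth.det.log hC.det_ne_zero))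

theorem pd_gaussianLogLik (hC : IsCovFamily Θ C) (hθ : θ ∈ Θ) (l : Fin k) (x : ι → ℝ) :
    pd l (gaussianLogLik C x) θ = -(1 / 2) * (x ⬝ᵥ (matPd l (fun θ => (C θ)⁻¹) θ *ᵥ x)) -
      1 / 2 * ((C θ)⁻¹ * matPd l C θ).trace := by
  have h1 := hasLineDerivAt_pd hC.isOpen
    ((contDiffOn_quadraticForm hC.smooth_inv x).of_le (by norm_num)) hθ l
  have h2 := hasLineDerivAt_pd hC.isOpen
    ((hC.smooth.det.log hC.det_ne_zero).of_le (by norm_num)) hθ l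
  rw [pd_quadraticForm hC.isOpen (hC.smooth_inv.of_le (by norm_num)) hθ] at h1
  rw [pd_log_det hC.isOpen (hC.smooth.of_le (by norm_num)) hC.det_ne_zero hθ] at h2
  exact ((HasDerivAt.const_mul (-(1 / 2)) h1).sub (HasDerivAt.const_mul (1 / 2) h2)).deriv

theorem pd2_gaussianLogLik (hC : IsCovFamily Θ C) (hθ : θ ∈ Θ) (j l : Fin k) (x : ι → ℝ) :
    pd2 j l (gaussianLogLik C x) θ =
      -(1 / 2) * (x ⬝ᵥ (matPd j (matPd l fun θ => (C θ)⁻¹) θ *ᵥ x)) -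
      1 / 2 * (matPd j (fun θ => (C θ)⁻¹ * matPd l C θ) θ).trace := by
  rw [pd2, pd_congr hC.isOpen (fun θ hθ => hC.pd_gaussianLogLik hθ l x) hθ]
  exact pd_quadraticForm_sub_trace hC.isOpen ((hC.smooth_inv.matPd hC.isOpen l).of_le (by norm_num))
    ((hC.smooth_inv_mul l).of_le (by norm_num)) hθ j x

theorem pd3_gaussianLogLik (hC : IsCovFamily Θ C) (hθ : θ ∈ Θ) (i j l : Fin k) (x : ι → ℝ) :
    pd3 i j l (gaussianLogLik C x) θ =
      -(1 / 2) * (x ⬝ᵥ (matPd i (matPd j (matPd l fun θ => (C θ)⁻¹)) θ *ᵥ x)) -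
      1 / 2 * (matPd i (matPd j (fun θ => (C θ)⁻¹ * matPd l C θ)) θ).trace := by
  rw [pd3, pd_congr hC.isOpen (f := pd j (pd l (gaussianLogLik C x)))
    (fun θ hθ => hC.pd2_gaussianLogLik hθ j l x) hθ]
  exact pd_quadraticForm_sub_trace hC.isOpen ((hC.smooth_inv.matPd hC.isOpen l).matPd hC.isOpen j)
    ((hC.smooth_inv_mul l).matPd hC.isOpen j) hθ i x

theorem matPd_inv_mul (hC : IsCovFamily Θ C) {X : (Fin k → ℝ) → Matrix ι ι ℝ}
    (hX : MatContDiffOn Θ 1 X) (hθ : θ ∈ Θ)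
    (i : Fin k) : matPd i (fun θ => (C θ)⁻¹ * X θ) θ =
      (C θ)⁻¹ * matPd i X θ - (C θ)⁻¹ * matPd i C θ * (C θ)⁻¹ * X θ := by
  rw [matPd_mul hC.isOpen (hC.smooth_inv.of_le (by norm_num)) hX hθ,
    matPd_inv hC.isOpen (hC.smooth.of_le (by norm_num)) hC.det_ne_zero hθ]
  noncomm_ring

theorem matPd_inv_mul_inv_mul (hC : IsCovFamily Θ C) {X Y : (Fin k → ℝ) → Matrix ι ι ℝ}
    (hX : MatContDiffOn Θ 1 X) (hY : MatContDiffOn Θ 1 Y) (hθ : θ ∈ Θ) (i : Fin k) :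
    matPd i (fun θ => (C θ)⁻¹ * X θ * ((C θ)⁻¹ * Y θ)) θ =
      (C θ)⁻¹ * matPd i X θ * ((C θ)⁻¹ * Y θ) + (C θ)⁻¹ * X θ * ((C θ)⁻¹ * matPd i Y θ) -
      (C θ)⁻¹ * matPd i C θ * ((C θ)⁻¹ * X θ) * ((C θ)⁻¹ * Y θ) -
      (C θ)⁻¹ * X θ * ((C θ)⁻¹ * matPd i C θ) * ((C θ)⁻¹ * Y θ) := by
  have hW := hC.smooth_inv.of_le (show 1 ≤ 3 by norm_num)
  rw [matPd_mul hC.isOpen (hW.mul hX) (hW.mul hY) hθ, hC.matPd_inv_mul hX hθ,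
    hC.matPd_inv_mul hY hθ]
  noncomm_ring

theorem matPd_matPd_inv_mul (hC : IsCovFamily Θ C) (hθ : θ ∈ Θ) (j l : Fin k) :
    matPd j (fun θ => (C θ)⁻¹ * matPd l C θ) θ =
      (C θ)⁻¹ * matPd j (matPd l C) θ - (C θ)⁻¹ * matPd j C θ * ((C θ)⁻¹ * matPd l C θ) := by
  rw [hC.matPd_inv_mul ((hC.smooth.matPd hC.isOpen l).of_le (by norm_num)) hθ]
  noncomm_ring

theorem matPd_matPd_inv (hC : IsCovFamily Θ C) (hθ : θ ∈ Θ) (j l : Fin k) :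
    matPd j (matPd l fun θ => (C θ)⁻¹) θ =
      ((C θ)⁻¹ * matPd j C θ * ((C θ)⁻¹ * matPd l C θ) +
        (C θ)⁻¹ * matPd l C θ * ((C θ)⁻¹ * matPd j C θ) -
        (C θ)⁻¹ * matPd j (matPd l C) θ) * (C θ)⁻¹ := by
  have h1 := hC.smooth.of_le (show 1 ≤ 3 by norm_num)
  have hW := hC.smooth_inv.of_le (show 1 ≤ 3 by norm_num)
  rw [matPd_congr hC.isOpen (fun θ hθ => matPd_inv hC.isOpen h1 hC.det_ne_zero hθ l) hθ,
    matPd_neg, matPd_mul hC.isOpen ((hC.smooth_inv_mul l).of_le (by norm_num)) hW hθ,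
    hC.matPd_matPd_inv_mul hθ, matPd_inv hC.isOpen h1 hC.det_ne_zero hθ]
  noncomm_ring

/-- The third derivative of `log det C`, before taking the trace. -/
theorem matPd_matPd_matPd_inv_mul (hC : IsCovFamily Θ C) (hθ : θ ∈ Θ) (i j l : Fin k) :
    matPd i (matPd j fun θ => (C θ)⁻¹ * matPd l C θ) θ =
      (C θ)⁻¹ * matPd i (matPd j (matPd l C)) θ -
      (C θ)⁻¹ * matPd i C θ * ((C θ)⁻¹ * matPd j (matPd l C) θ) -
      (C θ)⁻¹ * matPd i (matPd j C) θ * ((C θ)⁻¹ * matPd l C θ) -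
      (C θ)⁻¹ * matPd j C θ * ((C θ)⁻¹ * matPd i (matPd l C) θ) +
      (C θ)⁻¹ * matPd i C θ * ((C θ)⁻¹ * matPd j C θ) * ((C θ)⁻¹ * matPd l C θ) +
      (C θ)⁻¹ * matPd j C θ * ((C θ)⁻¹ * matPd i C θ) * ((C θ)⁻¹ * matPd l C θ) := by
  have hW := hC.smooth_inv.of_le (show 1 ≤ 3 by norm_num)
  have hA := fun l => (hC.smooth.matPd hC.isOpen l).of_le (show 1 ≤ 2 by norm_num)
  have hB := (hC.smooth.matPd hC.isOpen l).matPd hC.isOpen j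
  rw [matPd_congr hC.isOpen (fun θ hθ => hC.matPd_matPd_inv_mul hθ j l) hθ]
  simp only [sub_eq_add_neg]
  rw [matPd_add hC.isOpen (hW.mul hB) ((hW.mul (hA j)).mul (hW.mul (hA l))).neg hθ, matPd_neg,
    hC.matPd_inv_mul hB hθ, hC.matPd_inv_mul_inv_mul (hA j) (hA l) hθ]
  noncomm_ring

/-- The third derivative of `C⁻¹`. -/
theorem matPd_matPd_matPd_inv (hC : IsCovFamily Θ C) (hθ : θ ∈ Θ) (i j l : Fin k) :
    matPd i (matPd j (matPd l fun θ => (C θ)⁻¹)) θ =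
      ((C θ)⁻¹ * matPd i (matPd j C) θ * ((C θ)⁻¹ * matPd l C θ) +
        (C θ)⁻¹ * matPd l C θ * ((C θ)⁻¹ * matPd i (matPd j C) θ) +
        (C θ)⁻¹ * matPd i (matPd l C) θ * ((C θ)⁻¹ * matPd j C θ) +
        (C θ)⁻¹ * matPd j C θ * ((C θ)⁻¹ * matPd i (matPd l C) θ) +
        (C θ)⁻¹ * matPd j (matPd l C) θ * ((C θ)⁻¹ * matPd i C θ) +
        (C θ)⁻¹ * matPd i C θ * ((C θ)⁻¹ * matPd j (matPd l C) θ) -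
        (C θ)⁻¹ * matPd i (matPd j (matPd l C)) θ -
        (C θ)⁻¹ * matPd i C θ * ((C θ)⁻¹ * matPd j C θ) * ((C θ)⁻¹ * matPd l C θ) -
        (C θ)⁻¹ * matPd j C θ * ((C θ)⁻¹ * matPd i C θ) * ((C θ)⁻¹ * matPd l C θ) -
        (C θ)⁻¹ * matPd j C θ * ((C θ)⁻¹ * matPd l C θ) * ((C θ)⁻¹ * matPd i C θ) -
        (C θ)⁻¹ * matPd i C θ * ((C θ)⁻¹ * matPd l C θ) * ((C θ)⁻¹ * matPd j C θ) -
        (C θ)⁻¹ * matPd l C θ * ((C θ)⁻¹ * matPd i C θ) * ((C θ)⁻¹ * matPd j C θ) -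
        (C θ)⁻¹ * matPd l C θ * ((C θ)⁻¹ * matPd j C θ) * ((C θ)⁻¹ * matPd i C θ)) *
        (C θ)⁻¹ := by
  have h1 := hC.smooth.of_le (show 1 ≤ 3 by norm_num)
  have hW := hC.smooth_inv.of_le (show 1 ≤ 3 by norm_num)
  have hA := fun l => (hC.smooth.matPd hC.isOpen l).of_le (show 1 ≤ 2 by norm_num)
  have hB := (hC.smooth.matPd hC.isOpen l).matPd hC.isOpen j
  have hs := ((hW.mul (hA j)).mul (hW.mul (hA l))).add ((hW.mul (hA l)).mul (hW.mul (hA j)))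
  rw [matPd_congr hC.isOpen (fun θ hθ => hC.matPd_matPd_inv hθ j l) hθ]
  simp only [sub_eq_add_neg]
  rw [matPd_mul hC.isOpen (hs.add (hW.mul hB).neg) hW hθ,
    matPd_add hC.isOpen hs (hW.mul hB).neg hθ,
    matPd_add hC.isOpen ((hW.mul (hA j)).mul (hW.mul (hA l)))
      ((hW.mul (hA l)).mul (hW.mul (hA j))) hθ, matPd_neg, hC.matPd_inv_mul hB hθ,
    hC.matPd_inv_mul_inv_mul (hA j) (hA l) hθ, hC.matPd_inv_mul_inv_mul (hA l) (hA j) hθ,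
    matPd_inv hC.isOpen h1 hC.det_ne_zero hθ]
  noncomm_ring

end IsCovFamily

end GaussianLikelihood

section GaussianExpectations

variable {k : ℕ} {Θ : Set (Fin k → ℝ)} {θ : Fin k → ℝ} {ι : Type*}

theorem IsCovFamily.isSymm_matPd {C : (Fin k → ℝ) → Matrix ι ι ℝ} (hC : IsCovFamily Θ C)
    (hθ : θ ∈ Θ) (i : Fin k) : (matPd i C θ).IsSymm := by
  ext s t
  exact pd_congr hC.isOpen (f := fun θ => C θ t s) (g := fun θ => C θ s t)
    (fun θ hθ => by simpa using (hC.posDef θ hθ).1.apply s t) hθ i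

variable [Fintype ι]

/-- For symmetric matrices, transposition reverses the cyclic order of the factors under the trace,
so that the trace is a symmetric function of `X`, `Y`, `Z`. -/
theorem trace_mul_swap_of_isSymm {W X Y Z : Matrix ι ι ℝ} (hW : W.IsSymm) (hX : X.IsSymm)
    (hY : Y.IsSymm) (hZ : Z.IsSymm) :
    (W * X * (W * Z) * (W * Y)).trace = (W * X * (W * Y) * (W * Z)).trace := by
  rw [← trace_transpose (W * X * (W * Z) * (W * Y))]
  simp only [transpose_mul, hW.eq, hX.eq, hY.eq, hZ.eq, ← Matrix.mul_assoc]
  rw [trace_mul_comm]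
  simp only [← Matrix.mul_assoc]
  rw [trace_mul_comm, ← Matrix.mul_assoc, trace_mul_comm]
  simp only [← Matrix.mul_assoc]

variable [DecidableEq ι] {C : (Fin k → ℝ) → Matrix ι ι ℝ}

namespace IsCovFamily

theorem isSymm_inv (hC : IsCovFamily Θ C) (hθ : θ ∈ Θ) : ((C θ)⁻¹).IsSymm := by
  have h : (C θ).IsSymm := by simpa using (hC.posDef θ hθ).1
  rw [IsSymm, transpose_nonsing_inv, h.eq]

/-- The traces that enter the expectation of a second derivative of the log likelihood; the second
derivatives of `C` cancel. -/
theorem trace_second (hC : IsCovFamily Θ C) (hθ : θ ∈ Θ) (i j : Fin k) :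
    (matPd i (matPd j fun θ => (C θ)⁻¹) θ * C θ).trace +
      (matPd i (fun θ => (C θ)⁻¹ * matPd j C θ) θ).trace =
    ((C θ)⁻¹ * matPd i C θ * ((C θ)⁻¹ * matPd j C θ)).trace := by
  rw [hC.matPd_matPd_inv hθ, hC.matPd_matPd_inv_mul hθ, Matrix.mul_assoc,
    nonsing_inv_mul _ (hC.det_ne_zero θ hθ).isUnit, mul_one]
  simp only [trace_add, trace_sub]
  rw [trace_mul_comm ((C θ)⁻¹ * matPd j C θ)]
  ring

/-- The traces that enter the expectation of a third derivative of the log likelihood; the third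
derivatives of `C` cancel. -/
theorem trace_third (hC : IsCovFamily Θ C) (hθ : θ ∈ Θ) (i j l : Fin k) :
    (matPd i (matPd j (matPd l fun θ => (C θ)⁻¹)) θ * C θ).trace +
      (matPd i (matPd j fun θ => (C θ)⁻¹ * matPd l C θ) θ).trace =
    ((C θ)⁻¹ * matPd j (matPd l C) θ * ((C θ)⁻¹ * matPd i C θ)).trace +
      ((C θ)⁻¹ * matPd i (matPd l C) θ * ((C θ)⁻¹ * matPd j C θ)).trace +
      ((C θ)⁻¹ * matPd i (matPd j C) θ * ((C θ)⁻¹ * matPd l C θ)).trace -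
      4 * ((C θ)⁻¹ * matPd i C θ * ((C θ)⁻¹ * matPd j C θ) * ((C θ)⁻¹ * matPd l C θ)).trace := by
  have hs := trace_mul_swap_of_isSymm (hC.isSymm_inv hθ) (hC.isSymm_matPd hθ i)
    (hC.isSymm_matPd hθ j) (hC.isSymm_matPd hθ l)
  rw [hC.matPd_matPd_matPd_inv hθ, hC.matPd_matPd_matPd_inv_mul hθ, Matrix.mul_assoc,
    nonsing_inv_mul _ (hC.det_ne_zero θ hθ).isUnit, mul_one]
  simp only [trace_add, trace_sub]
  generalize (C θ)⁻¹ * matPd i C θ = a at *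
  generalize (C θ)⁻¹ * matPd j C θ = b at *
  generalize (C θ)⁻¹ * matPd l C θ = c at *
  linear_combination trace_mul_comm c ((C θ)⁻¹ * matPd i (matPd j C) θ) - trace_mul_cycle b c a -
    2 * hs + trace_mul_cycle a b c - trace_mul_cycle c b a

theorem integrable_pd2 (hC : IsCovFamily Θ C) (hθ : θ ∈ Θ) (i j : Fin k)
    (μ : Measure (EuclideanSpace ℝ ι)) [IsGaussian μ] :
    Integrable (fun x => pd2 i j (gaussianLogLik C x.ofLp) θ) μ := by
  simp only [hC.pd2_gaussianLogLik hθ]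
  exact ((integrable_quadraticForm _ μ).const_mul _).sub (integrable_const _)

theorem integrable_pd3 (hC : IsCovFamily Θ C) (hθ : θ ∈ Θ) (i j l : Fin k)
    (μ : Measure (EuclideanSpace ℝ ι)) [IsGaussian μ] :
    Integrable (fun x => pd3 i j l (gaussianLogLik C x.ofLp) θ) μ := by
  simp only [hC.pd3_gaussianLogLik hθ]
  exact ((integrable_quadraticForm _ μ).const_mul _).sub (integrable_const _)

theorem integral_pd2 (hC : IsCovFamily Θ C) (hθ : θ ∈ Θ) (i j : Fin k) :
    ∫ x, pd2 i j (gaussianLogLik C x.ofLp) θ ∂(multivariateGaussian 0 (C θ)) =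
      -(1 / 2) * ((C θ)⁻¹ * matPd i C θ * ((C θ)⁻¹ * matPd j C θ)).trace := by
  simp only [hC.pd2_gaussianLogLik hθ]
  rw [integral_sub ((integrable_quadraticForm _ _).const_mul _) (integrable_const _),
    integral_const_mul, integral_quadraticForm (hC.posDef θ hθ).posSemidef, integral_const,
    ← hC.trace_second hθ]
  simp
  ring

theorem integral_pd3 (hC : IsCovFamily Θ C) (hθ : θ ∈ Θ) (i j l : Fin k) :
    ∫ x, pd3 i j l (gaussianLogLik C x.ofLp) θ ∂(multivariateGaussian 0 (C θ)) =
      2 * ((C θ)⁻¹ * matPd i C θ * ((C θ)⁻¹ * matPd j C θ) * ((C θ)⁻¹ * matPd l C θ)).trace -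
      1 / 2 * (((C θ)⁻¹ * matPd j (matPd l C) θ * ((C θ)⁻¹ * matPd i C θ)).trace +
      ((C θ)⁻¹ * matPd i (matPd l C) θ * ((C θ)⁻¹ * matPd j C θ)).trace +
      ((C θ)⁻¹ * matPd i (matPd j C) θ * ((C θ)⁻¹ * matPd l C θ)).trace) := by
  have h := hC.trace_third hθ i j l
  simp only [hC.pd3_gaussianLogLik hθ]
  rw [integral_sub ((integrable_quadraticForm _ _).const_mul _) (integrable_const _),
    integral_const_mul, integral_quadraticForm (hC.posDef θ hθ).posSemidef, integral_const]
  simp only [probReal_univ, one_smul]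
  linear_combination (-1 / 2) * h

/-- The product of a second and a first derivative, as a polynomial in quadratic forms. -/
theorem pd2_mul_pd_eq (hC : IsCovFamily Θ C) (hθ : θ ∈ Θ) (i j l : Fin k) :
    ∃ (A B : Matrix ι ι ℝ) (c : ℝ), A = matPd i (matPd j fun θ => (C θ)⁻¹) θ ∧
      B = matPd l (fun θ => (C θ)⁻¹) θ ∧
      ∀ x : EuclideanSpace ℝ ι,
        pd2 i j (gaussianLogLik C x.ofLp) θ * pd l (gaussianLogLik C x.ofLp) θ =
        1 / 4 * (x.ofLp ⬝ᵥ (A *ᵥ x.ofLp) * (x.ofLp ⬝ᵥ (B *ᵥ x.ofLp)) +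
          ((C θ)⁻¹ * matPd l C θ).trace * (x.ofLp ⬝ᵥ (A *ᵥ x.ofLp)) +
          c * (x.ofLp ⬝ᵥ (B *ᵥ x.ofLp)) + c * ((C θ)⁻¹ * matPd l C θ).trace) := by
  refine ⟨_, _, (matPd i (fun θ => (C θ)⁻¹ * matPd j C θ) θ).trace, rfl, rfl, fun x => ?_⟩
  rw [hC.pd2_gaussianLogLik hθ, hC.pd_gaussianLogLik hθ]
  ring

theorem integrable_pd2_mul_pd (hC : IsCovFamily Θ C) (hθ : θ ∈ Θ) (i j l : Fin k)
    (μ : Measure (EuclideanSpace ℝ ι)) [IsGaussian μ] :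
    Integrable (fun x => pd2 i j (gaussianLogLik C x.ofLp) θ *
      pd l (gaussianLogLik C x.ofLp) θ) μ := by
  obtain ⟨A, B, c, -, -, h⟩ := hC.pd2_mul_pd_eq hθ i j l
  simp only [h]
  exact ((((integrable_quadraticForm_mul A B μ).add
    ((integrable_quadraticForm A μ).const_mul _)).add
    ((integrable_quadraticForm B μ).const_mul _)).add (integrable_const _)).const_mul _

theorem integral_pd2_mul_pd (hC : IsCovFamily Θ C) (hθ : θ ∈ Θ) (i j l : Fin k) :
    ∫ x, pd2 i j (gaussianLogLik C x.ofLp) θ * pd l (gaussianLogLik C x.ofLp) θ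
        ∂(multivariateGaussian 0 (C θ)) =
      1 / 2 * ((C θ)⁻¹ * matPd i (matPd j C) θ * ((C θ)⁻¹ * matPd l C θ)).trace -
      ((C θ)⁻¹ * matPd i C θ * ((C θ)⁻¹ * matPd j C θ) * ((C θ)⁻¹ * matPd l C θ)).trace := by
  obtain ⟨A, B, c, hA, hB, h⟩ := hC.pd2_mul_pd_eq hθ i j l
  have hps := (hC.posDef θ hθ).posSemidef
  have hu := (hC.det_ne_zero θ hθ).isUnit
  have hB' : B = -((C θ)⁻¹ * matPd l C θ * (C θ)⁻¹) :=
    hB.trans (matPd_inv hC.isOpen (hC.smooth.of_le (by norm_num)) hC.det_ne_zero hθ l)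
  have hBs : B.IsSymm := by
    rw [hB', IsSymm, transpose_neg, transpose_mul, transpose_mul, (hC.isSymm_inv hθ).eq,
      (hC.isSymm_matPd hθ l).eq, Matrix.mul_assoc]
  have hBC : B * C θ = -((C θ)⁻¹ * matPd l C θ) := by
    rw [hB', neg_mul, Matrix.mul_assoc, nonsing_inv_mul _ hu, mul_one]
  have hAC : A * C θ = (C θ)⁻¹ * matPd i C θ * ((C θ)⁻¹ * matPd j C θ) +
        (C θ)⁻¹ * matPd j C θ * ((C θ)⁻¹ * matPd i C θ) - (C θ)⁻¹ * matPd i (matPd j C) θ := by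
    rw [hA, hC.matPd_matPd_inv hθ, Matrix.mul_assoc, nonsing_inv_mul _ hu, mul_one]
  have i0 := integrable_quadraticForm_mul A B (multivariateGaussian 0 (C θ))
  have i1 := (integrable_quadraticForm A (multivariateGaussian 0 (C θ))).const_mul
    ((C θ)⁻¹ * matPd l C θ).trace
  have i2 := (integrable_quadraticForm B (multivariateGaussian 0 (C θ))).const_mul c
  have i01 : Integrable (fun x : EuclideanSpace ℝ ι => x.ofLp ⬝ᵥ (A *ᵥ x.ofLp) *
      (x.ofLp ⬝ᵥ (B *ᵥ x.ofLp)) + ((C θ)⁻¹ * matPd l C θ).trace * (x.ofLp ⬝ᵥ (A *ᵥ x.ofLp)))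
      (multivariateGaussian 0 (C θ)) := i0.add i1
  have i012 : Integrable (fun x : EuclideanSpace ℝ ι => x.ofLp ⬝ᵥ (A *ᵥ x.ofLp) *
      (x.ofLp ⬝ᵥ (B *ᵥ x.ofLp)) + ((C θ)⁻¹ * matPd l C θ).trace * (x.ofLp ⬝ᵥ (A *ᵥ x.ofLp)) +
      c * (x.ofLp ⬝ᵥ (B *ᵥ x.ofLp))) (multivariateGaussian 0 (C θ)) := i01.add i2
  have hs := trace_mul_swap_of_isSymm (hC.isSymm_inv hθ) (hC.isSymm_matPd hθ i)
    (hC.isSymm_matPd hθ j) (hC.isSymm_matPd hθ l)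
  simp only [h]
  rw [integral_const_mul, integral_add i012 (integrable_const _),
    integral_add i01 i2, integral_add i0 i1, integral_const_mul, integral_const_mul,
    integral_quadraticForm_mul hps A hBs, integral_quadraticForm hps, integral_quadraticForm hps,
    Matrix.mul_assoc (A * C θ) B, hBC, hAC, integral_const, probReal_univ, one_smul]
  simp only [Matrix.mul_neg, trace_neg, Matrix.add_mul, Matrix.sub_mul, trace_add, trace_sub]
  rw [← trace_mul_cycle _ ((C θ)⁻¹ * matPd l C θ) ((C θ)⁻¹ * matPd j C θ), hs]
  ring

end IsCovFamily

end GaussianExpectations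

/-! ### Covariance matrices of ARMA models -/

section Model

theorem IsSpectralDensity.pos {f : ℝ → ℝ} (hf : IsSpectralDensity f) (ω : ℝ) : 0 < f ω := by
  obtain ⟨p, q, φ, ψ, v, hv, ha, hb, h⟩ := hf
  have hn : ‖Complex.exp (-(ω * Complex.I))‖ = 1 := by
    rw [← neg_mul, ← Complex.ofReal_neg, Complex.norm_exp_ofReal_mul_I]
  have h1 := norm_pos_iff.2 (ha _ hn)
  have h2 := norm_pos_iff.2 (hb _ hn)
  rw [h]
  positivity

theorem IsSpectralDensity.even {f : ℝ → ℝ} (hf : IsSpectralDensity f) (ω : ℝ) :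
    f (-ω) = f ω := by
  obtain ⟨p, q, φ, ψ, v, hv, ha, hb, h⟩ := hf
  have he : Complex.exp (-((-ω : ℝ) * Complex.I)) =
      (starRingEnd ℂ) (Complex.exp (-(ω * Complex.I))) := by
    rw [← Complex.exp_conj]
    simp
  have h1 : ∀ z, arPoly φ ((starRingEnd ℂ) z) = (starRingEnd ℂ) (arPoly φ z) := fun z => by
    simp [arPoly]
  have h2 : ∀ z, maPoly ψ ((starRingEnd ℂ) z) = (starRingEnd ℂ) (maPoly ψ z) := fun z => by
    simp [maPoly]
  rw [h, h, he, h1, h2, Complex.norm_conj, Complex.norm_conj]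

variable {k : ℕ} {Θ : Set (Fin k → ℝ)} {θ : Fin k → ℝ} {F : (Fin k → ℝ) → ℝ → ℝ}

theorem cov_eq_toeplitz (F : (Fin k → ℝ) → ℝ → ℝ) (n : ℕ) (θ : Fin k → ℝ) :
    cov F n θ = toeplitz (fun ω => 2 * π * F θ ω) n := by
  ext s t
  simp only [cov, toeplitz, cosCoeff, of_apply]
  rw [← intervalIntegral.integral_const_mul]
  refine intervalIntegral.integral_congr fun ω _ => ?_
  have := Real.pi_ne_zero
  push_cast
  field_simp

theorem pd_const_mul (i : Fin k) (c : ℝ) (f : (Fin k → ℝ) → ℝ) (θ : Fin k → ℝ) :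
    pd i (fun t => c * f t) θ = c * pd i f θ :=
  deriv_const_mul_field c

theorem matContDiffOn_cov (hΘ : IsOpen Θ) {m : ℕ} (hF : JointlyContDiff Θ m F) (n : ℕ) :
    MatContDiffOn Θ m (cov F n) := fun s t =>
  (hF.mul_left (w := fun ω => Real.cos (((s.val : ℝ) - t.val) * ω))
    (Real.contDiff_cos.comp (contDiff_const.mul contDiff_id))).contDiffOn_integral hΘ _ _

/-- Differentiation under the integral sign: the derivatives of the covariance matrices are the
matrices built from the derivatives of the spectral density. -/
theorem matPd_cov (hΘ : IsOpen Θ) (hF : JointlyContDiff Θ 1 F) (hθ : θ ∈ Θ) (n : ℕ)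
    (i : Fin k) : matPd i (cov F n) θ = cov (fun θ ω => pd i (fun t => F t ω) θ) n θ := by
  ext s t
  refine ((hF.mul_left (w := fun ω => Real.cos (((s.val : ℝ) - t.val) * ω))
    (Real.contDiff_cos.comp (contDiff_const.mul contDiff_id))).pd_integral hΘ hθ _ _ i).trans ?_
  simp only [pd_const_mul]
  rfl

namespace IsModel

variable {S : (Fin k → ℝ) → ℝ → ℝ}

theorem jointlyContDiff (hS : IsModel Θ S) : JointlyContDiff Θ 3 S := hS.smooth

theorem jointlyContDiff_pd (hS : IsModel Θ S) (i : Fin k) :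
    JointlyContDiff Θ 2 fun θ ω => pd i (fun t => S t ω) θ :=
  hS.jointlyContDiff.pd hS.isOpen i

theorem jointlyContDiff_pd2 (hS : IsModel Θ S) (i j : Fin k) :
    JointlyContDiff Θ 1 fun θ ω => pd2 i j (fun t => S t ω) θ :=
  (hS.jointlyContDiff_pd j).pd hS.isOpen i

theorem isSymbol (hS : IsModel Θ S) (hθ : θ ∈ Θ) : IsSymbol (S θ) :=
  ⟨(hS.jointlyContDiff.of_le (by norm_num)).apply_right hθ, (hS.spectral θ hθ).even⟩

theorem pd_neg (hS : IsModel Θ S) (hθ : θ ∈ Θ) (i : Fin k) (ω : ℝ) :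
    pd i (fun t => S t (-ω)) θ = pd i (fun t => S t ω) θ :=
  pd_congr hS.isOpen (fun _ ht => (hS.spectral _ ht).even ω) hθ i

theorem isSymbol_pd (hS : IsModel Θ S) (hθ : θ ∈ Θ) (i : Fin k) :
    IsSymbol fun ω => pd i (fun t => S t ω) θ :=
  ⟨((hS.jointlyContDiff_pd i).of_le (by norm_num)).apply_right hθ, hS.pd_neg hθ i⟩

theorem isSymbol_pd2 (hS : IsModel Θ S) (hθ : θ ∈ Θ) (i j : Fin k) :
    IsSymbol fun ω => pd2 i j (fun t => S t ω) θ :=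
  ⟨(hS.jointlyContDiff_pd2 i j).apply_right hθ, fun ω =>
    pd_congr hS.isOpen (fun _ ht => hS.pd_neg ht j ω) hθ i⟩

theorem isCovFamily (hS : IsModel Θ S) (n : ℕ) : IsCovFamily Θ (cov S n) := by
  refine ⟨hS.isOpen, matContDiffOn_cov hS.isOpen hS.jointlyContDiff n, fun θ hθ => ?_⟩
  have hc := (hS.isSymbol hθ).const_mul (2 * π)
  obtain ⟨x, -, hx⟩ := isCompact_Icc.exists_isMinOn (s := Set.Icc (-π) π)
    ⟨0, by constructor <;> linarith [Real.pi_pos]⟩ hc.continuous.continuousOn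
  rw [cov_eq_toeplitz]
  exact posDef_toeplitz hc.continuous
    (mul_pos Real.two_pi_pos ((hS.spectral θ hθ).pos x)) (fun ω hω => hx hω) n

theorem dlog_eq (hS : IsModel Θ S) (hθ : θ ∈ Θ) (i : Fin k) (ω : ℝ) :
    dlog S θ i ω = pd i (fun t => S t ω) θ / S θ ω := by
  have h := hasLineDerivAt_pd hS.isOpen (θ := θ) (f := fun t => S t ω)
    ((hS.jointlyContDiff.of_le (show 1 ≤ 3 by norm_num)).apply_left ω) hθ i
  have h' := HasDerivAt.log h (by simpa using ((hS.spectral θ hθ).pos ω).ne')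
  refine h'.deriv.trans ?_
  simp only [zero_smul, add_zero]

/-- If the matrices `A n` are the Toeplitz matrices of `2 π f`, then the matrices `Σ_n⁻¹ A n` have
the symbol `f / S`. -/
theorem isAsympToeplitz_inv_mul (hS : IsModel Θ S) (hθ : θ ∈ Θ) {f : ℝ → ℝ} (hf : IsSymbol f) :
    IsAsympToeplitz (fun n => (cov S n θ)⁻¹ * toeplitz (fun ω => 2 * π * f ω) n)
      fun ω => f ω / S θ ω := by
  have h := (isAsympToeplitz_inv ((hS.isSymbol hθ).const_mul (2 * π)) fun ω =>
    mul_pos Real.two_pi_pos ((hS.spectral θ hθ).pos ω)).mul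
    (isAsympToeplitz_toeplitz (hf.const_mul (2 * π)))
  simp only [← cov_eq_toeplitz] at h
  convert h using 2 with ω
  have := ((hS.spectral θ hθ).pos ω).ne'
  have := Real.pi_ne_zero
  field_simp

theorem isAsympToeplitz_pd (hS : IsModel Θ S) (hθ : θ ∈ Θ) (i : Fin k) :
    IsAsympToeplitz (fun n => (cov S n θ)⁻¹ * matPd i (cov S n) θ) (dlog S θ i) := by
  convert hS.isAsympToeplitz_inv_mul hθ (hS.isSymbol_pd hθ i) using 2 with n ω
  · rw [matPd_cov hS.isOpen (hS.jointlyContDiff.of_le (by norm_num)) hθ, cov_eq_toeplitz (n := n)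
      (F := fun θ ω => pd i (fun t => S t ω) θ)]
  · exact hS.dlog_eq hθ i ω

theorem isAsympToeplitz_pd2 (hS : IsModel Θ S) (hθ : θ ∈ Θ) (i j : Fin k) :
    IsAsympToeplitz (fun n => (cov S n θ)⁻¹ * matPd i (matPd j (cov S n)) θ)
      fun ω => pd2 i j (fun t => S t ω) θ / S θ ω := by
  convert hS.isAsympToeplitz_inv_mul hθ (hS.isSymbol_pd2 hθ i j) using 3 with n
  rw [matPd_congr hS.isOpen (fun θ hθ => matPd_cov hS.isOpen
    (hS.jointlyContDiff.of_le (by norm_num)) hθ n j) hθ,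
    matPd_cov hS.isOpen ((hS.jointlyContDiff_pd j).of_le (by norm_num)) hθ, cov_eq_toeplitz]
  rfl

end IsModel

end Model

/-! ### Asymptotics -/

section Asymptotics

/-- The trace of an asymptotically Toeplitz sequence, divided by `n`, tends to the mean of the
symbol at the rate `n⁻¹`. -/
theorem IsAsympToeplitz.isBigO {M : ∀ n : ℕ, Matrix (Fin n) (Fin n) ℝ} {f : ℝ → ℝ}
    (hM : IsAsympToeplitz M f) :
    (fun n : ℕ => (n : ℝ)⁻¹ * (M n).trace - ∫ ω in (-π)..π, f ω / (2 * π))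
      =O[atTop] fun n : ℕ => (n : ℝ)⁻¹ := by
  obtain ⟨C, hC⟩ := hM.trace
  refine Asymptotics.IsBigO.of_bound C ?_
  filter_upwards [eventually_gt_atTop 0] with n hn
  have hn' : (0 : ℝ) < n := by exact_mod_cast hn
  have e : (n : ℝ)⁻¹ * (M n).trace - ∫ ω in (-π)..π, f ω / (2 * π) =
      ((M n).trace - n * cosCoeff f 0) * (n : ℝ)⁻¹ := by
    rw [intervalIntegral.integral_div, cosCoeff]
    simp
    field_simp
  rw [e, norm_mul]
  exact mul_le_mul_of_nonneg_right (hC n) (norm_nonneg _)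

theorem isBigO_inv_one : (fun n : ℕ => (n : ℝ)⁻¹) =O[atTop] fun _ : ℕ => (1 : ℝ) :=
  tendsto_inv_atTop_nhds_zero_nat.isBigO_one ℝ

theorem isBigO_one_of_sub {a : ℕ → ℝ} {c : ℝ}
    (h : (fun n => a n - c) =O[atTop] fun n : ℕ => (n : ℝ)⁻¹) :
    a =O[atTop] fun _ : ℕ => (1 : ℝ) := by
  have h1 := (h.trans isBigO_inv_one).add (Asymptotics.isBigO_const_const c one_ne_zero atTop)
  simpa using h1

/-- The rate of convergence of matrices passes to their inverses. -/
theorem isBigO_inv_sub_inv {ι : Type*} [Fintype ι] [DecidableEq ι] {M : ℕ → Matrix ι ι ℝ}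
    {G : Matrix ι ι ℝ} (hG : IsUnit G.det)
    (h : ∀ i j, (fun n => M n i j - G i j) =O[atTop] fun n : ℕ => (n : ℝ)⁻¹) :
    (∀ᶠ n in atTop, IsUnit (M n).det) ∧
    ∀ i j, (fun n => (M n)⁻¹ i j - G⁻¹ i j) =O[atTop] fun n : ℕ => (n : ℝ)⁻¹ := by
  have ht : Tendsto M atTop (𝓝 G) := tendsto_pi_nhds.2 fun i => tendsto_pi_nhds.2 fun j =>
    tendsto_sub_nhds_zero_iff.1 ((h i j).trans_tendsto tendsto_inv_atTop_nhds_zero_nat)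
  have hdet : Tendsto (fun n => (M n).det) atTop (𝓝 G.det) :=
    (continuous_id.matrix_det.tendsto G).comp ht
  have hadj : Tendsto (fun n => (M n).adjugate) atTop (𝓝 G.adjugate) :=
    (continuous_id.matrix_adjugate.tendsto G).comp ht
  have hu : ∀ᶠ n in atTop, IsUnit (M n).det :=
    (hdet.eventually_ne hG.ne_zero).mono fun n hn => hn.isUnit
  refine ⟨hu, fun i j => ?_⟩
  have hinv : ∀ i j, (fun n => (M n)⁻¹ i j) =O[atTop] fun _ : ℕ => (1 : ℝ) := fun i j => by
    have h1 := ((hdet.inv₀ hG.ne_zero).mul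
      (tendsto_pi_nhds.1 (tendsto_pi_nhds.1 hadj i) j)).isBigO_one ℝ
    simpa only [inv_def, Ring.inverse_eq_inv', Matrix.smul_apply, smul_eq_mul] using h1
  have hsum : (fun n => ∑ b, (∑ a, (M n)⁻¹ i a * (M n a b - G a b)) * (-G⁻¹ b j))
      =O[atTop] fun n : ℕ => (n : ℝ)⁻¹ := by
    refine Asymptotics.IsBigO.fun_sum fun b _ => ?_
    have h2 : (fun n => ∑ a, (M n)⁻¹ i a * (M n a b - G a b)) =O[atTop]
        fun n : ℕ => (n : ℝ)⁻¹ := by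
      refine Asymptotics.IsBigO.fun_sum fun a _ => ?_
      have h3 := (hinv i a).mul (h a b)
      simpa only [one_mul] using h3
    simpa only [mul_comm] using h2.const_mul_left (-G⁻¹ b j)
  refine hsum.congr' (hu.mono fun n hn => ?_) EventuallyEq.rfl
  -- the resolvent identity
  have e : (M n)⁻¹ * (M n - G) * (-G⁻¹) = (M n)⁻¹ - G⁻¹ := by
    rw [Matrix.mul_sub, nonsing_inv_mul _ hn, Matrix.mul_neg, Matrix.sub_mul, Matrix.one_mul,
      Matrix.mul_assoc, mul_nonsing_inv _ hG, Matrix.mul_one, neg_sub]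
  have e' := congrFun₂ e i j
  simpa only [mul_apply, Matrix.sub_apply, Matrix.neg_apply] using e'

end Asymptotics

section Moments

variable {k : ℕ} {Θ : Set (Fin k → ℝ)} {θ : Fin k → ℝ} {S : (Fin k → ℝ) → ℝ → ℝ}

theorem tensorT_swap (S : (Fin k → ℝ) → ℝ → ℝ) (θ : Fin k → ℝ) (i j l : Fin k) :
    tensorT S θ j i l = tensorT S θ i j l :=
  intervalIntegral.integral_congr fun ω _ => by ring

theorem tensorT_rotate (S : (Fin k → ℝ) → ℝ → ℝ) (θ : Fin k → ℝ) (i j l : Fin k) :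
    tensorT S θ l i j = tensorT S θ i j l :=
  intervalIntegral.integral_congr fun ω _ => by ring

namespace IsModel

theorem m2_eq (hS : IsModel Θ S) (hθ : θ ∈ Θ) (n : ℕ) (i j : Fin k) :
    m2 S n θ θ i j = -(1 / 2) * ((n : ℝ)⁻¹ *
      ((cov S n θ)⁻¹ * matPd i (cov S n) θ * ((cov S n θ)⁻¹ * matPd j (cov S n) θ)).trace) := by
  have h := (hS.isCovFamily n).integral_pd2 hθ i j
  rw [mul_left_comm, ← h, ← integral_const_mul]
  rfl

theorem m3_eq (hS : IsModel Θ S) (hθ : θ ∈ Θ) (n : ℕ) (i j l : Fin k) :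
    m3 S n θ θ i j l = 2 * ((n : ℝ)⁻¹ *
      ((cov S n θ)⁻¹ * matPd i (cov S n) θ * ((cov S n θ)⁻¹ * matPd j (cov S n) θ) *
        ((cov S n θ)⁻¹ * matPd l (cov S n) θ)).trace) -
      1 / 2 * ((n : ℝ)⁻¹ * ((cov S n θ)⁻¹ * matPd j (matPd l (cov S n)) θ *
        ((cov S n θ)⁻¹ * matPd i (cov S n) θ)).trace +
      (n : ℝ)⁻¹ * ((cov S n θ)⁻¹ * matPd i (matPd l (cov S n)) θ *
        ((cov S n θ)⁻¹ * matPd j (cov S n) θ)).trace +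
      (n : ℝ)⁻¹ * ((cov S n θ)⁻¹ * matPd i (matPd j (cov S n)) θ *
        ((cov S n θ)⁻¹ * matPd l (cov S n) θ)).trace) := by
  have h := (hS.isCovFamily n).integral_pd3 hθ i j l
  have h1 : m3 S n θ θ i j l = (n : ℝ)⁻¹ * ∫ x, pd3 i j l (gaussianLogLik (cov S n) x.ofLp) θ
      ∂(multivariateGaussian 0 (cov S n θ)) := by
    rw [← integral_const_mul]
    rfl
  rw [h1, h]
  ring

theorem mul_m21_eq (hS : IsModel Θ S) (hθ : θ ∈ Θ) (n : ℕ) (i j l : Fin k) :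
    n * m21 S n θ θ i j l =
      1 / 2 * ((n : ℝ)⁻¹ * ((cov S n θ)⁻¹ * matPd i (matPd j (cov S n)) θ *
        ((cov S n θ)⁻¹ * matPd l (cov S n) θ)).trace) -
      (n : ℝ)⁻¹ * ((cov S n θ)⁻¹ * matPd i (cov S n) θ *
        ((cov S n θ)⁻¹ * matPd j (cov S n) θ) *
        ((cov S n θ)⁻¹ * matPd l (cov S n) θ)).trace := by
  have h := (hS.isCovFamily n).integral_pd2_mul_pd hθ i j l
  have h1 : m21 S n θ θ i j l = (n : ℝ)⁻¹ * (n : ℝ)⁻¹ *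
      ∫ x, pd2 i j (gaussianLogLik (cov S n) x.ofLp) θ * pd l (gaussianLogLik (cov S n) x.ofLp) θ
      ∂(multivariateGaussian 0 (cov S n θ)) := by
    rw [← integral_const_mul]
    refine integral_congr_ae (Eventually.of_forall fun x => ?_)
    change (n : ℝ)⁻¹ * pd2 i j (gaussianLogLik (cov S n) x.ofLp) θ *
      ((n : ℝ)⁻¹ * pd l (gaussianLogLik (cov S n) x.ofLp) θ) = _
    ring
  rw [h1, h]
  rcases Nat.eq_zero_or_pos n with rfl | hn
  · simp
  · have : (n : ℝ) ≠ 0 := by positivity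
    field_simp

theorem isBigO_trace_metric (hS : IsModel Θ S) (hθ : θ ∈ Θ) (i j : Fin k) :
    (fun n : ℕ => (n : ℝ)⁻¹ * ((cov S n θ)⁻¹ * matPd i (cov S n) θ *
      ((cov S n θ)⁻¹ * matPd j (cov S n) θ)).trace - 2 * metric S θ i j)
      =O[atTop] fun n : ℕ => (n : ℝ)⁻¹ := by
  convert ((hS.isAsympToeplitz_pd hθ i).mul (hS.isAsympToeplitz_pd hθ j)).isBigO using 3
  rw [metric, of_apply, ← intervalIntegral.integral_const_mul]
  exact intervalIntegral.integral_congr fun ω _ => by field_simp; ring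

theorem isBigO_trace_gammaM (hS : IsModel Θ S) (hθ : θ ∈ Θ) (i j l : Fin k) :
    (fun n : ℕ => (n : ℝ)⁻¹ * ((cov S n θ)⁻¹ * matPd i (matPd j (cov S n)) θ *
      ((cov S n θ)⁻¹ * matPd l (cov S n) θ)).trace - 2 * gammaM S θ l i j)
      =O[atTop] fun n : ℕ => (n : ℝ)⁻¹ := by
  convert ((hS.isAsympToeplitz_pd2 hθ i j).mul (hS.isAsympToeplitz_pd hθ l)).isBigO using 3
  rw [gammaM, ← intervalIntegral.integral_const_mul]
  exact intervalIntegral.integral_congr fun ω _ => by field_simp; ring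

theorem isBigO_trace_tensorT (hS : IsModel Θ S) (hθ : θ ∈ Θ) (i j l : Fin k) :
    (fun n : ℕ => (n : ℝ)⁻¹ * ((cov S n θ)⁻¹ * matPd i (cov S n) θ *
      ((cov S n θ)⁻¹ * matPd j (cov S n) θ) *
      ((cov S n θ)⁻¹ * matPd l (cov S n) θ)).trace - tensorT S θ i j l)
      =O[atTop] fun n : ℕ => (n : ℝ)⁻¹ :=
  (((hS.isAsympToeplitz_pd hθ i).mul (hS.isAsympToeplitz_pd hθ j)).mul
    (hS.isAsympToeplitz_pd hθ l)).isBigO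

theorem isBigO_m2 (hS : IsModel Θ S) (hθ : θ ∈ Θ) (i j : Fin k) :
    (fun n : ℕ => m2 S n θ θ i j - (-metric S θ i j)) =O[atTop] fun n : ℕ => (n : ℝ)⁻¹ :=
  ((hS.isBigO_trace_metric hθ i j).const_mul_left (-(1 / 2))).congr_left fun n => by
    rw [hS.m2_eq hθ]; ring

theorem isBigO_m3 (hS : IsModel Θ S) (hθ : θ ∈ Θ) (i j l : Fin k) :
    (fun n : ℕ => m3 S n θ θ i j l - (2 * tensorT S θ i j l -
      (gammaM S θ i j l + gammaM S θ j i l + gammaM S θ l i j)))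
      =O[atTop] fun n : ℕ => (n : ℝ)⁻¹ :=
  (((hS.isBigO_trace_tensorT hθ i j l).const_mul_left 2).sub
    ((((hS.isBigO_trace_gammaM hθ j l i).add (hS.isBigO_trace_gammaM hθ i l j)).add
      (hS.isBigO_trace_gammaM hθ i j l)).const_mul_left (1 / 2))).congr_left fun n => by
    rw [hS.m3_eq hθ]; ring

theorem isBigO_m21 (hS : IsModel Θ S) (hθ : θ ∈ Θ) (i j l : Fin k) :
    (fun n : ℕ => n * m21 S n θ θ i j l - (gammaM S θ l i j - tensorT S θ i j l))
      =O[atTop] fun n : ℕ => (n : ℝ)⁻¹ :=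
  (((hS.isBigO_trace_gammaM hθ i j l).const_mul_left (1 / 2)).sub
    (hS.isBigO_trace_tensorT hθ i j l)).congr_left fun n => by
    rw [hS.mul_m21_eq hθ]; ring

end IsModel

end Moments

end ARMA

end

theorem lemma3 {k : ℕ} (Θ : Set (Fin k → ℝ)) (S : (Fin k → ℝ) → ℝ → ℝ) (hS : ARMA.IsModel Θ S)
    (θ₀ : Fin k → ℝ) (hθ₀ : θ₀ ∈ Θ) :
    -- the Gaussian laws, the derivatives and the expectations below are well defined
    (∀ n : ℕ, (ARMA.cov S n θ₀).PosDef) ∧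
    (∀ (n : ℕ) (x : EuclideanSpace ℝ (Fin n)), ContDiffAt ℝ 3 (ARMA.logLik S n x) θ₀) ∧
    (∀ (n : ℕ) (i j l : Fin k),
      Integrable (ARMA.L2 S n θ₀ i j) (ARMA.law S n θ₀) ∧
      Integrable (ARMA.L3 S n θ₀ i j l) (ARMA.law S n θ₀) ∧
      Integrable (fun x => ARMA.L2 S n θ₀ i j x * ARMA.L1 S n θ₀ l x) (ARMA.law S n θ₀)) ∧
    -- `m_{ij}`
    (∀ i j : Fin k,
      (fun n : ℕ => ARMA.m2 S n θ₀ θ₀ i j - (-ARMA.metric S θ₀ i j))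
        =O[atTop] (fun n : ℕ => (n : ℝ)⁻¹) ∧
      (fun n : ℕ => ARMA.m2 S n θ₀ θ₀ i j) =O[atTop] (fun _ : ℕ => (1 : ℝ))) ∧
    -- `m^{ij}`
    (IsUnit (ARMA.metric S θ₀).det →
      (∀ᶠ n : ℕ in atTop, IsUnit (ARMA.m2 S n θ₀ θ₀).det) ∧
      ∀ i j : Fin k,
        (fun n : ℕ => (ARMA.m2 S n θ₀ θ₀)⁻¹ i j - (-(ARMA.metric S θ₀)⁻¹ i j))
          =O[atTop] (fun n : ℕ => (n : ℝ)⁻¹) ∧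
        (fun n : ℕ => (ARMA.m2 S n θ₀ θ₀)⁻¹ i j) =O[atTop] (fun _ : ℕ => (1 : ℝ))) ∧
    -- `m_{ijl}`
    (∀ i j l : Fin k,
      (fun n : ℕ => ARMA.m3 S n θ₀ θ₀ i j l - (2 * ARMA.tensorT S θ₀ i j l -
          (ARMA.gammaM S θ₀ i j l + ARMA.gammaM S θ₀ j i l + ARMA.gammaM S θ₀ l i j)))
        =O[atTop] (fun n : ℕ => (n : ℝ)⁻¹) ∧
      (fun n : ℕ => ARMA.m3 S n θ₀ θ₀ i j l - (-(ARMA.gammaE S θ₀ i j l + ARMA.gammaE S θ₀ j i l +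
          ARMA.gammaE S θ₀ l i j + ARMA.tensorT S θ₀ i j l)))
        =O[atTop] (fun n : ℕ => (n : ℝ)⁻¹) ∧
      (fun n : ℕ => ARMA.m3 S n θ₀ θ₀ i j l) =O[atTop] (fun _ : ℕ => (1 : ℝ))) ∧
    -- `n m_{ij,l}`
    (∀ i j l : Fin k,
      (fun n : ℕ => n * ARMA.m21 S n θ₀ θ₀ i j l -
          (ARMA.gammaM S θ₀ l i j - ARMA.tensorT S θ₀ i j l))
        =O[atTop] (fun n : ℕ => (n : ℝ)⁻¹) ∧
      (fun n : ℕ => n * ARMA.m21 S n θ₀ θ₀ i j l - ARMA.gammaE S θ₀ l i j)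
        =O[atTop] (fun n : ℕ => (n : ℝ)⁻¹) ∧
      (fun n : ℕ => n * ARMA.m21 S n θ₀ θ₀ i j l) =O[atTop] (fun _ : ℕ => (1 : ℝ))) := by
  have h2 := hS.isBigO_m2 hθ₀
  have h3 := hS.isBigO_m3 hθ₀
  have h21 := hS.isBigO_m21 hθ₀
  refine ⟨fun n => (hS.isCovFamily n).posDef θ₀ hθ₀, fun n x =>
    ((hS.isCovFamily n).contDiffOn_gaussianLogLik x.ofLp).contDiffAt (hS.isOpen.mem_nhds hθ₀),
    fun n i j l => ⟨?_, ?_, ?_⟩, fun i j => ⟨h2 i j, ARMA.isBigO_one_of_sub (h2 i j)⟩,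
    fun hg => ?_, fun i j l => ⟨h3 i j l, ?_, ARMA.isBigO_one_of_sub (h3 i j l)⟩,
    fun i j l => ⟨h21 i j l, ?_, ARMA.isBigO_one_of_sub (h21 i j l)⟩⟩
  · exact ((hS.isCovFamily n).integrable_pd2 hθ₀ i j
      (multivariateGaussian 0 (ARMA.cov S n θ₀))).const_mul _
  · exact ((hS.isCovFamily n).integrable_pd3 hθ₀ i j l
      (multivariateGaussian 0 (ARMA.cov S n θ₀))).const_mul _
  · refine (((hS.isCovFamily n).integrable_pd2_mul_pd hθ₀ i j l
      (multivariateGaussian 0 (ARMA.cov S n θ₀))).const_mul ((n : ℝ)⁻¹ * (n : ℝ)⁻¹)).congr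
      (Eventually.of_forall fun x => ?_)
    change _ = (n : ℝ)⁻¹ * ARMA.pd2 i j (ARMA.gaussianLogLik (ARMA.cov S n) x.ofLp) θ₀ *
      ((n : ℝ)⁻¹ * ARMA.pd l (ARMA.gaussianLogLik (ARMA.cov S n) x.ofLp) θ₀)
    ring
  · have hinv : (-ARMA.metric S θ₀)⁻¹ = -(ARMA.metric S θ₀)⁻¹ :=
      inv_eq_right_inv (by rw [neg_mul_neg, mul_nonsing_inv _ hg])
    have hu : IsUnit (-ARMA.metric S θ₀).det := by
      rw [det_neg]
      exact (isUnit_one.neg.pow _).mul hg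
    obtain ⟨h, h'⟩ := ARMA.isBigO_inv_sub_inv hu h2
    rw [hinv] at h'
    exact ⟨h, fun i j => ⟨h' i j, ARMA.isBigO_one_of_sub (h' i j)⟩⟩
  · refine (h3 i j l).congr_left fun n => ?_
    simp only [ARMA.gammaE, ARMA.tensorT_swap S θ₀ i j l, ARMA.tensorT_rotate S θ₀ i j l]
    ring
  · refine (h21 i j l).congr_left fun n => ?_
    rw [ARMA.gammaE, ARMA.tensorT_rotate S θ₀ i j l]
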